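/- Let $\mathbb K$ be a field of characteristic $\neq 2$, $s\ge 0$, and let $(g_{\lambda\mu})_{0\le\lambda,\mu\le s}$ be an invertible symmetric matrix over $\mathbb K$ with inverse $(g^{\lambda\mu})$; repeated indices are summed over $\{0,\dots,s\}$. Let $T$ be the free associative unital algebra on $S_0,\dots,S_s$ and $F^n\subset T$ the space of elements of degree $\le n$. Put $$\tilde W^\rho=[g^{\lambda\mu}S_\lambda S_\mu,\,g^{\rho\nu}S_\nu]=(g^{\lambda\mu}g^{\nu\rho}-g^{\rho\lambda}g^{\mu\nu})S_\lambda S_\mu S_\nu ,\qquad \tilde J^\rho=\tilde\jmath^{\alpha\beta\rho}S_\alpha S_\beta+\tilde\jmath^{\alpha\rho}S_\alpha+\tilde\jmath^\rho 1$$ with arbitrary coefficients $\tilde\jmath^{\alpha\beta\rho},\tilde\jmath^{\alpha\rho},\tilde\jmath^\rho\in\mathbb K$. Let $P$ be the span of the elements $\tilde W^\rho-\tilde J^\rho$, $R$ the projection of $P$ to the degree-$3$ component of $T$, $A=T/(R)$ (a graded algebra) and $U=T/(P)$ with the filtration given by the images of the $F^n$, so that $U$ is the algebra with generators $S_\lambda$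 and relations $\tilde W^\rho=\tilde J^\rho$. One says that $U$ has the PBW property if the canonical homomorphism of graded algebras $A\to\operatorname{gr}(U)$ is an isomorphism. (1) $U$ has the PBW property if and only if there are $b_\rho\in\mathbb K$ and $\omega^{\alpha\beta}=-\omega^{\beta\alpha}\in\mathbb K$ such that for all $\alpha,\beta,\gamma$ $$\tilde\jmath^{\alpha\beta\gamma}=(g^{\alpha\gamma}g^{\beta\rho}-g^{\beta\gamma}g^{\alpha\rho})b_\rho,\qquad \tilde\jmath^{\alpha\beta}=\omega^{\alpha\beta},\qquad \tilde\jmath^{\alpha}=-\tfrac12\omega^{\alpha\rho}b_\rho .\qquad(*)$$ (2) Let $b_\rho\in\mathbb K$, $\omega^{\alpha\beta}=-\omega^{\beta\alpha}\in\mathbb K$, and put $\hat S_\lambda=S_\lambda+\tfrac12 b_\lambda 1$. Then the matrix $(\omega^{\tau\rho}g_{\rho\nu})_{\tau\nu}$ lies in $\mathfrak{so}(s+1,g)=\{M: M^{T}g+gM=0\}$, and $(*)$ holds for these $b,\omega$ if and only if the relations $\tilde W^\rho=\tilde J^\rho$ are equivalent to (generate the same two-sided ideal of $T$ as) the relations $$[g^{\lambda\mu}\hat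 S_\lambda\hat S_\mu,\hat S_\nu]=\omega^{\tau\rho}g_{\rho\nu}\hat S_\tau\qquad(0\le\nu\le s).$$ In that case $\operatorname{ad}(g^{\lambda\mu}\hat S_\lambda\hat S_\mu)$ acts on the generators $\hat S_\nu$ in $U$ as this infinitesimal rotation. (3) Consequently, $U$ has the PBW property if and only if there are $b_\rho\in\mathbb K$ and $M\in\mathfrak{so}(s+1,g)$ such that, with $\hat S_\lambda=S_\lambda+\tfrac12b_\lambda 1$, the relations $\tilde W^\rho=\tilde J^\rho$ are equivalent, in the same sense, to the relations $[g^{\lambda\mu}\hat S_\lambda\hat S_\mu,\hat S_\nu]=M^\tau{}_\nu\hat S_\tau$ ($0\le\nu\le s$). (4) For the opposite sign convention, that is for the algebra with relations $-\tilde W^\rho=\tilde J^\rho$, the statement (1) holds with the third formula replaced by $\tilde\jmath^{\alpha}=+\tfrac12\omega^{\alpha\rho}b_\rho$. -/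

import Mathlib

noncomputable section

namespace InhomAlg

/-! ### Algebras with inhomogeneous relations and the PBW property -/

section General

variable {K : Type*} [Field K] {V : Type*} [AddCommGroup V] [Module K V]

/-- `V^{⊗n}`, as a subspace of the tensor algebra `T(V)`. -/
def tens (K : Type*) [Field K] (V : Type*) [AddCommGroup V] [Module K V] (n : ℕ) :
    Submodule K (TensorAlgebra K V) :=
  LinearMap.range (TensorAlgebra.ι K : V →ₗ[K] TensorAlgebra K V) ^ n

instance tens.gradedAlgebra : GradedAlgebra (tens K V) :=
  inferInstanceAs (GradedAlgebra
    ((LinearMap.range (TensorAlgebra.ι K : V →ₗ[K] TensorAlgebra K V) ^ ·) :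
      ℕ → Submodule K (TensorAlgebra K V)))

/-- `⊕_{i < n} V^{⊗i}`; it is `0` for `n = 0`. -/
def filtLT (K : Type*) [Field K] (V : Type*) [AddCommGroup V] [Module K V] (n : ℕ) :
    Submodule K (TensorAlgebra K V) :=
  ⨆ i, ⨆ (_ : i < n), tens K V i

/-- The filtration `F^n = ⊕_{i ≤ n} V^{⊗i}` of `T(V)`. -/
def filt (K : Type*) [Field K] (V : Type*) [AddCommGroup V] [Module K V] (n : ℕ) :
    Submodule K (TensorAlgebra K V) :=
  ⨆ i, ⨆ (_ : i ≤ n), tens K V i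

/-- The projection `π` of `T(V)` onto `V^{⊗N}`. -/
def proj (K : Type*) [Field K] (V : Type*) [AddCommGroup V] [Module K V] (N : ℕ) :
    TensorAlgebra K V →ₗ[K] TensorAlgebra K V :=
  GradedAlgebra.proj (tens K V) N

/-- The two-sided ideal `(P)` of `T(V)` generated by a subspace `P`. -/
def relIdeal (P : Submodule K (TensorAlgebra K V)) : TwoSidedIdeal (TensorAlgebra K V) :=
  TwoSidedIdeal.span (P : Set (TensorAlgebra K V))

/-- The algebra `T(V)/(P)`. -/
abbrev QuotAlg (P : Submodule K (TensorAlgebra K V)) : Type _ :=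
  (relIdeal P).ringCon.Quotient

/-- The canonical projection `T(V) → T(V)/(P)`. -/
def toQuot (P : Submodule K (TensorAlgebra K V)) : TensorAlgebra K V →ₐ[K] QuotAlg P :=
  (relIdeal P).ringCon.mkₐ K

theorem toQuot_eq_zero_iff (P : Submodule K (TensorAlgebra K V)) (x : TensorAlgebra K V) :
    toQuot P x = 0 ↔ x ∈ relIdeal P := by
  rw [← map_zero (toQuot P), TwoSidedIdeal.mem_iff]
  exact RingCon.eq _

/-- The homogeneous part `R = π(P) ⊆ V^{⊗N}` of the relations. -/
def homPart (N : ℕ) (P : Submodule K (TensorAlgebra K V)) : Submodule K (TensorAlgebra K V) :=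
  P.map (proj K V N)

/-- The component of degree `n` of the graded algebra `A = T(V)/(R)`, `R = π(P)`. -/
def homDeg (N : ℕ) (P : Submodule K (TensorAlgebra K V)) (n : ℕ) :
    Submodule K (QuotAlg (homPart N P)) :=
  (tens K V n).map (toQuot (homPart N P)).toLinearMap

/-- The step `F^n U` of the filtration of `U = T(V)/(P)`: the image of `F^n`. -/
def quotFilt (P : Submodule K (TensorAlgebra K V)) (n : ℕ) : Submodule K (QuotAlg P) :=
  (filt K V n).map (toQuot P).toLinearMap

/-- The step `F^{n-1} U`, which is `0` for `n = 0`. -/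
def quotFiltLT (P : Submodule K (TensorAlgebra K V)) (n : ℕ) : Submodule K (QuotAlg P) :=
  (filtLT K V n).map (toQuot P).toLinearMap

/-- The component `gr_n(U) = F^n U / F^{n-1} U` of the associated graded algebra of `U`. -/
abbrev gr (P : Submodule K (TensorAlgebra K V)) (n : ℕ) : Type _ :=
  (quotFilt P n) ⧸ (quotFiltLT P n).submoduleOf (quotFilt P n)

theorem tens_le_filt (n : ℕ) : tens K V n ≤ filt K V n :=
  le_iSup₂_of_le n le_rfl le_rfl

theorem tens_le_filtLT {i n : ℕ} (h : i < n) : tens K V i ≤ filtLT K V n :=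
  le_iSup₂_of_le i h le_rfl

theorem mul_mem_filtLT_left {i m : ℕ} {a y : TensorAlgebra K V} (ha : a ∈ tens K V i)
    (hy : y ∈ filtLT K V m) : a * y ∈ filtLT K V (i + m) := by
  have h : filtLT K V m ≤ (filtLT K V (i + m)).comap (LinearMap.mulLeft K a) := by
    refine iSup₂_le fun j hj z hz => ?_
    exact tens_le_filtLT (by omega : i + j < i + m) (SetLike.mul_mem_graded ha hz)
  exact h hy

theorem mul_mem_filtLT_right {i m : ℕ} {a y : TensorAlgebra K V} (ha : a ∈ tens K V i)
    (hy : y ∈ filtLT K V m) : y * a ∈ filtLT K V (m + i) := by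
  have h : filtLT K V m ≤ (filtLT K V (m + i)).comap (LinearMap.mulRight K a) := by
    refine iSup₂_le fun j hj z hz => ?_
    exact tens_le_filtLT (by omega : j + i < m + i) (SetLike.mul_mem_graded hz ha)
  exact h hy

theorem proj_mem (n : ℕ) (x : TensorAlgebra K V) : proj K V n x ∈ tens K V n :=
  SetLike.coe_mem _

theorem proj_of_mem {n : ℕ} {x : TensorAlgebra K V} (hx : x ∈ tens K V n) :
    proj K V n x = x :=
  DirectSum.decompose_of_mem_same (tens K V) hx

theorem proj_of_mem_ne {m n : ℕ} {x : TensorAlgebra K V} (hx : x ∈ tens K V m) (h : m ≠ n) :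
    proj K V n x = 0 :=
  DirectSum.decompose_of_mem_ne (tens K V) hx h

theorem proj_mul_left {i : ℕ} {a : TensorAlgebra K V} (ha : a ∈ tens K V i) (n : ℕ)
    (x : TensorAlgebra K V) :
    proj K V n (a * x) = if i ≤ n then a * proj K V (n - i) x else 0 :=
  DirectSum.coe_decompose_mul_of_left_mem (tens K V) n ha

theorem proj_mul_right {i : ℕ} {a : TensorAlgebra K V} (ha : a ∈ tens K V i) (n : ℕ)
    (x : TensorAlgebra K V) :
    proj K V n (x * a) = if i ≤ n then proj K V (n - i) x * a else 0 :=
  DirectSum.coe_decompose_mul_of_right_mem (tens K V) n ha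

theorem sub_proj_mem {N : ℕ} {p : TensorAlgebra K V} (hp : p ∈ filt K V N) :
    p - proj K V N p ∈ filtLT K V N := by
  have h : filt K V N ≤ (filtLT K V N).comap (LinearMap.id - proj K V N) := by
    refine iSup₂_le fun j hj z hz => ?_
    rcases eq_or_lt_of_le hj with rfl | hlt
    · simp [proj_of_mem hz]
    · simpa [proj_of_mem_ne hz hlt.ne] using tens_le_filtLT hlt hz
  exact h hp

/-- Every homogeneous component of an element of `(R)` is, modulo `(P)`, of lower degree. -/
theorem exists_lower {N : ℕ} {P : Submodule K (TensorAlgebra K V)} (hP : P ≤ filt K V N)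
    {x : TensorAlgebra K V} (hx : x ∈ relIdeal (homPart N P)) (n : ℕ) :
    ∃ y ∈ filtLT K V n, proj K V n x - y ∈ relIdeal P := by
  induction hx using TwoSidedIdeal.span_induction generalizing n with
  | mem x hx =>
    obtain ⟨p, hp, rfl⟩ := hx
    by_cases h : N = n
    · subst h
      refine ⟨-(p - proj K V N p), neg_mem (sub_proj_mem (hP hp)), ?_⟩
      rw [proj_of_mem (proj_mem N p)]
      have : proj K V N p - -(p - proj K V N p) = p := by abel
      rw [this]
      exact TwoSidedIdeal.subset_span hp
    · exact ⟨0, zero_mem _, by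
        rw [proj_of_mem_ne (proj_mem N p) h, sub_zero]; exact (relIdeal P).zero_mem⟩
  | zero => exact ⟨0, zero_mem _, by rw [map_zero, sub_zero]; exact (relIdeal P).zero_mem⟩
  | add x y _ _ hx hy =>
    obtain ⟨u, hu, hxu⟩ := hx n
    obtain ⟨v, hv, hyv⟩ := hy n
    refine ⟨u + v, add_mem hu hv, ?_⟩
    rw [map_add, add_sub_add_comm]
    exact (relIdeal P).add_mem hxu hyv
  | neg x _ hx =>
    obtain ⟨u, hu, hxu⟩ := hx n
    refine ⟨-u, neg_mem hu, ?_⟩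
    rw [map_neg, ← neg_sub']
    exact (relIdeal P).neg_mem hxu
  | left_absorb a x _ hx =>
    induction a using DirectSum.Decomposition.inductionOn (tens K V) with
    | zero =>
      exact ⟨0, zero_mem _, by
        rw [zero_mul, map_zero, sub_zero]; exact (relIdeal P).zero_mem⟩
    | @homogeneous i a =>
      rw [proj_mul_left a.2]
      split_ifs with h
      · obtain ⟨u, hu, hxu⟩ := hx (n - i)
        refine ⟨a * u, ?_, ?_⟩
        · have := mul_mem_filtLT_left a.2 hu
          rwa [Nat.add_sub_cancel' h] at this
        · rw [← mul_sub]
          exact (relIdeal P).mul_mem_left _ _ hxu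
      · exact ⟨0, zero_mem _, by rw [sub_zero]; exact (relIdeal P).zero_mem⟩
    | add a b ha hb =>
      obtain ⟨u, hu, hxu⟩ := ha
      obtain ⟨v, hv, hyv⟩ := hb
      refine ⟨u + v, add_mem hu hv, ?_⟩
      rw [add_mul, map_add, add_sub_add_comm]
      exact (relIdeal P).add_mem hxu hyv
  | right_absorb a x _ hx =>
    induction a using DirectSum.Decomposition.inductionOn (tens K V) with
    | zero =>
      exact ⟨0, zero_mem _, by
        rw [mul_zero, map_zero, sub_zero]; exact (relIdeal P).zero_mem⟩
    | @homogeneous i a =>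
      rw [proj_mul_right a.2]
      split_ifs with h
      · obtain ⟨u, hu, hxu⟩ := hx (n - i)
        refine ⟨u * a, ?_, ?_⟩
        · have := mul_mem_filtLT_right a.2 hu
          rwa [Nat.sub_add_cancel h] at this
        · rw [← sub_mul]
          exact (relIdeal P).mul_mem_right _ _ hxu
      · exact ⟨0, zero_mem _, by rw [sub_zero]; exact (relIdeal P).zero_mem⟩
    | add a b ha hb =>
      obtain ⟨u, hu, hxu⟩ := ha
      obtain ⟨v, hv, hyv⟩ := hb
      refine ⟨u + v, add_mem hu hv, ?_⟩
      rw [mul_add, map_add, add_sub_add_comm]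
      exact (relIdeal P).add_mem hxu hyv

/-- The projection `V^{⊗n} → A_n`. -/
def tensToHomDeg (N : ℕ) (P : Submodule K (TensorAlgebra K V)) (n : ℕ) :
    tens K V n →ₗ[K] homDeg N P n :=
  (toQuot (homPart N P)).toLinearMap.submoduleMap (tens K V n)

theorem tensToHomDeg_surjective (N : ℕ) (P : Submodule K (TensorAlgebra K V)) (n : ℕ) :
    Function.Surjective (tensToHomDeg N P n) :=
  LinearMap.submoduleMap_surjective _ _

/-- The map `V^{⊗n} → gr_n(U)` sending `x` to the class of its image in `F^n U`. -/
def tensToGr (P : Submodule K (TensorAlgebra K V)) (n : ℕ) : tens K V n →ₗ[K] gr P n :=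
  Submodule.mkQ _ ∘ₗ (toQuot P).toLinearMap.submoduleMap (filt K V n) ∘ₗ
    Submodule.inclusion (tens_le_filt n)

theorem ker_tensToHomDeg_le (N : ℕ) {P : Submodule K (TensorAlgebra K V)}
    (hP : P ≤ filt K V N) (n : ℕ) :
    LinearMap.ker (tensToHomDeg N P n) ≤ LinearMap.ker (tensToGr P n) := by
  intro x hx
  have h0 : toQuot (homPart N P) (x : TensorAlgebra K V) = 0 := congrArg Subtype.val hx
  rw [toQuot_eq_zero_iff] at h0
  obtain ⟨y, hy, hxy⟩ := exists_lower hP h0 n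
  rw [proj_of_mem x.2, ← toQuot_eq_zero_iff, map_sub, sub_eq_zero] at hxy
  refine (Submodule.Quotient.mk_eq_zero _).2 ?_
  exact ⟨y, hy, hxy.symm⟩

/-- The component of degree `n` of the canonical graded morphism `p : A → gr(U)`: the class in
`A_n` of `x ∈ V^{⊗n}` goes to the class in `gr_n(U)` of `x`. -/
def grMap (N : ℕ) (P : Submodule K (TensorAlgebra K V)) (hP : P ≤ filt K V N) (n : ℕ) :
    homDeg N P n →ₗ[K] gr P n :=
  (LinearMap.ker (tensToHomDeg N P n)).liftQ (tensToGr P n) (ker_tensToHomDeg_le N hP n) ∘ₗ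
    ((tensToHomDeg N P n).quotKerEquivOfSurjective (tensToHomDeg_surjective N P n)).symm

theorem grMap_apply (N : ℕ) (P : Submodule K (TensorAlgebra K V)) (hP : P ≤ filt K V N) (n : ℕ)
    (x : tens K V n) : grMap N P hP n (tensToHomDeg N P n x) = tensToGr P n x := by
  have : ((tensToHomDeg N P n).quotKerEquivOfSurjective (tensToHomDeg_surjective N P n)).symm
      (tensToHomDeg N P n x) = Submodule.Quotient.mk x := by
    rw [LinearEquiv.symm_apply_eq]; rfl
  simp [grMap, this]

/-- The PBW property of `U = T(V)/(P)`, for a subspace `P` of `F^N`: the canonical morphism of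
graded algebras `p : T(V)/(π(P)) → gr(U)` is an isomorphism, i.e. bijective in each degree. -/
def HasPBW (N : ℕ) (P : Submodule K (TensorAlgebra K V)) (hP : P ≤ filt K V N) : Prop :=
  ∀ n, Function.Bijective (grMap N P hP n)

end General

/-! ### The super Yang–Mills relations -/

section SuperYM

variable {K : Type*} [Field K] {s : ℕ}

/-- The tensor algebra of the vector space with basis `S_0, …, S_s`. -/
abbrev Gen (K : Type*) [Field K] (s : ℕ) : Type _ := TensorAlgebra K (Fin (s + 1) → K)

/-- The generator `S_lam`. -/
def S (K : Type*) [Field K] {s : ℕ} (lam : Fin (s + 1)) : Gen K s :=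
  TensorAlgebra.ι K (Pi.single lam 1)

/-- `W^ρ = (g^{λμ} g^{νρ} - g^{ρλ} g^{μν}) S_λ ⊗ S_μ ⊗ S_ν = [g^{λμ} S_λ S_μ, g^{ρν} S_ν]`,
where `(g^{λμ})` is the inverse of the matrix `(g_{λμ})`. -/
def superW (g : Matrix (Fin (s + 1)) (Fin (s + 1)) K) (ρ : Fin (s + 1)) : Gen K s :=
  ∑ l, ∑ m, ∑ n, (g⁻¹ l m * g⁻¹ n ρ - g⁻¹ ρ l * g⁻¹ m n) • (S K l * S K m * S K n)

/-- `J^ρ = j^{αβρ} S_α ⊗ S_β + j^{αρ} S_α + j^ρ 1`. -/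
def current (j3 : Fin (s + 1) → Fin (s + 1) → Fin (s + 1) → K)
    (j2 : Fin (s + 1) → Fin (s + 1) → K) (j1 : Fin (s + 1) → K) (ρ : Fin (s + 1)) : Gen K s :=
  (∑ α, ∑ β, j3 α β ρ • (S K α * S K β)) + (∑ α, j2 α ρ • S K α) + algebraMap K _ (j1 ρ)

/-- The subspace of the tensor algebra spanned by the `X_ρ - Y_ρ`; the quotient by the ideal it
generates is the algebra with the relations `X_ρ = Y_ρ`. -/
def relSpace (X Y : Fin (s + 1) → Gen K s) : Submodule K (Gen K s) :=
  Submodule.span K (Set.range fun ρ => X ρ - Y ρ)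

theorem filt_mono {V : Type*} [AddCommGroup V] [Module K V] {m n : ℕ} (h : m ≤ n) :
    filt K V m ≤ filt K V n :=
  iSup₂_le fun i hi => le_iSup₂_of_le i (hi.trans h) le_rfl

theorem S_mem (l : Fin (s + 1)) : S K l ∈ tens K (Fin (s + 1) → K) 1 := by
  simp [tens, S]

theorem superW_mem (g : Matrix (Fin (s + 1)) (Fin (s + 1)) K) (ρ : Fin (s + 1)) :
    superW g ρ ∈ filt K (Fin (s + 1) → K) 3 :=
  tens_le_filt 3 <| sum_mem fun l _ => sum_mem fun m _ => sum_mem fun n _ =>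
    Submodule.smul_mem _ _ (SetLike.mul_mem_graded (SetLike.mul_mem_graded (S_mem l) (S_mem m))
      (S_mem n))

theorem current_mem (j3 : Fin (s + 1) → Fin (s + 1) → Fin (s + 1) → K)
    (j2 : Fin (s + 1) → Fin (s + 1) → K) (j1 : Fin (s + 1) → K) (ρ : Fin (s + 1)) :
    current j3 j2 j1 ρ ∈ filt K (Fin (s + 1) → K) 3 := by
  refine add_mem (add_mem ?_ ?_) ?_
  · exact filt_mono (by norm_num : 2 ≤ 3) <| tens_le_filt 2 <| sum_mem fun α _ =>
      sum_mem fun β _ => Submodule.smul_mem _ _ (SetLike.mul_mem_graded (S_mem α) (S_mem β))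
  · exact filt_mono (by norm_num : 1 ≤ 3) <| tens_le_filt 1 <| sum_mem fun α _ =>
      Submodule.smul_mem _ _ (S_mem α)
  · exact filt_mono (by norm_num : 0 ≤ 3) <| tens_le_filt 0 <|
      SetLike.algebraMap_mem_graded (tens K (Fin (s + 1) → K)) _

theorem relSpace_le {X Y : Fin (s + 1) → Gen K s}
    (hX : ∀ ρ, X ρ ∈ filt K (Fin (s + 1) → K) 3) (hY : ∀ ρ, Y ρ ∈ filt K (Fin (s + 1) → K) 3) :
    relSpace X Y ≤ filt K (Fin (s + 1) → K) 3 := by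
  refine Submodule.span_le.2 ?_
  rintro _ ⟨ρ, rfl⟩
  exact sub_mem (hX ρ) (hY ρ)

/-- The shifted generator `Ŝ_ν = S_ν + ½ b_ν 1`. -/
def shiftS (b : Fin (s + 1) → K) (ν : Fin (s + 1)) : Gen K s :=
  S K ν + algebraMap K _ (b ν / 2)

/-- The quadratic Casimir element `g^{λμ} Ŝ_λ Ŝ_μ`. -/
def casimir (g : Matrix (Fin (s + 1)) (Fin (s + 1)) K) (b : Fin (s + 1) → K) : Gen K s :=
  ∑ l, ∑ m, g⁻¹ l m • (shiftS b l * shiftS b m)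

/-- The transform `M^τ_ν Ŝ_τ` of `Ŝ_ν` under the linear map with matrix `M` in the basis `Ŝ`. -/
def rotated (M : Matrix (Fin (s + 1)) (Fin (s + 1)) K) (b : Fin (s + 1) → K)
    (ν : Fin (s + 1)) : Gen K s :=
  ∑ τ, M τ ν • shiftS b τ

/-- The components of the current in terms of `b_ρ` and `ω^{αβ}`:
`j^{αβγ} = (g^{αγ} g^{βρ} - g^{βγ} g^{αρ}) b_ρ`, `j^{αβ} = ω^{αβ}`, `j^α = -½ ω^{αρ} b_ρ`. -/
def CurrentForm (g : Matrix (Fin (s + 1)) (Fin (s + 1)) K)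
    (j3 : Fin (s + 1) → Fin (s + 1) → Fin (s + 1) → K)
    (j2 : Fin (s + 1) → Fin (s + 1) → K) (j1 : Fin (s + 1) → K)
    (b : Fin (s + 1) → K) (ω : Matrix (Fin (s + 1)) (Fin (s + 1)) K) : Prop :=
  (∀ α β γ, j3 α β γ = ∑ ρ, (g⁻¹ α γ * g⁻¹ β ρ - g⁻¹ β γ * g⁻¹ α ρ) * b ρ) ∧
  (∀ α β, j2 α β = ω α β) ∧
  (∀ α, j1 α = -(1 / 2) * ∑ ρ, ω α ρ * b ρ)

end SuperYM

end InhomAlg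

end

open InhomAlg

/-! Write `q = g^{λμ} S_λ S_μ` and `S^ρ = g^{ρν} S_ν`, so that `W^ρ = [q, S^ρ]`. Since `g` is
symmetric and `q = S_ρ S^ρ`, the identity `[q, q] = 0` is a linear syzygy `∑ (S_ρ W^ρ + W^ρ S_ρ) =
0` (`sum_anticomm_superW`). Everything rests on how it deforms.

Necessity. By the syzygy, `x = ∑ (S_ρ J^ρ + J^ρ S_ρ)` lies in the ideal `(P)`, and its degree is at
most 3. Under PBW such an element lies in `P`, so `x = ∑ b_ρ (W^ρ - J^ρ)` for some `b`
(`anticomm_current_eq_of_hasPBW`). Comparing coefficients of words turns this equation into the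
three formulas for the current, and conversely (`anticomm_current_eq_iff`); this is where 2 must be
invertible.

Sufficiency. Diagonalize, `q = ∑ a_k e_k²`, and order words by length, then lexicographically, with
largest letters `t > u`. The relation for `e_k` has leading word `ttk` if `k ≠ t` and `tuu` if `k =
t`. The only overlap is `ttuu`, and the deformed syzygy is exactly what resolves it (`ttuu_mem`).
The diamond lemma (`mem_multSpan_of_mem_wordSpan`) then shows that elements of `(P)` of degree at
most `n` are combinations of multiples of relations of degree at most `n`, which is PBW. With a
single generator there is no `u`, but then all relations are trivial.

Rotations. Completing the square, the relations `[q̂, Ŝ_ν] = ω^{τρ} g_{ρν} Ŝ_τ` with raised index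
are literally `W^ρ - J^ρ` for the current given by `b, ω` (`sum_smul_bracket`). Conversely the ideal
determines the current: two currents with the same ideal differ by elements of degree at most 2 in
it, and PBW leaves none but 0. Finally `ω ↦ ω g` matches antisymmetric matrices with `so(s+1, g)`.
-/

noncomputable section

namespace InhomAlg

/-! ### A diamond lemma for algebras with a multiplicative, well-ordered basis -/

section Diamond

variable {K A W ι : Type*} [Field K] [Ring A] [Algebra K A]

/-- The span of the basis elements indexed by `L`. -/
def wordSpan (B : Module.Basis W K A) (L : Set W) : Submodule K A :=
  Submodule.span K (B '' L)

/-- Multiplication moves spans of words. -/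
theorem mul_mem_of_mem_wordSpan {B : Module.Basis W K A} {L : Set W} {a b : A} {M : Submodule K A}
    (h : ∀ w ∈ L, a * B w * b ∈ M) {x : A} (hx : x ∈ wordSpan B L) : a * x * b ∈ M := by
  have : wordSpan B L ≤ M.comap (LinearMap.mulRight K b ∘ₗ LinearMap.mulLeft K a) := by
    refine Submodule.span_le.2 ?_
    rintro _ ⟨w, hw, rfl⟩
    simpa using h w hw
  simpa using this hx

theorem basis_mem_wordSpan {B : Module.Basis W K A} {L : Set W} {w : W} (h : w ∈ L) :
    B w ∈ wordSpan B L :=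
  Submodule.subset_span ⟨w, h, rfl⟩

theorem wordSpan_mono {B : Module.Basis W K A} {L L' : Set W} (h : L ⊆ L') :
    wordSpan B L ≤ wordSpan B L' :=
  Submodule.span_mono (Set.image_mono h)

theorem repr_eq_zero_of_mem_wordSpan {B : Module.Basis W K A} {L : Set W} {x : A}
    (hx : x ∈ wordSpan B L) {w : W} (hw : w ∉ L) : B.repr x w = 0 := by
  by_contra h
  exact hw ((B.mem_span_image.1 hx) (by simpa using h))

variable [Monoid W]

/-- Left multiplication by `B 1` fixes each basis element, so it is the identity map; its value at
`1` gives the claim. -/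
theorem basis_one {B : Module.Basis W K A} (hB : ∀ v w, B (v * w) = B v * B w) : B 1 = 1 := by
  have h : ∀ x : A, B 1 * x = x := by
    intro x
    have : LinearMap.mulLeft K (B 1) = LinearMap.id := B.ext fun w => by simp [← hB]
    exact LinearMap.congr_fun this x
  simpa using h 1

/-- The span of the multiples `a p_i b` of the relations, with leading word `a l_i b` in `L`. -/
def multSpan (B : Module.Basis W K A) (p : ι → A) (l : ι → W) (L : Set W) : Submodule K A :=
  Submodule.span K {x | ∃ a i b, a * l i * b ∈ L ∧ x = B a * p i * B b}

variable {B : Module.Basis W K A} {p : ι → A} {l : ι → W} {L L' : Set W}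

theorem mult_mem_multSpan {a b : W} {i : ι} (h : a * l i * b ∈ L) :
    B a * p i * B b ∈ multSpan B p l L :=
  Submodule.subset_span ⟨a, i, b, h, rfl⟩

theorem multSpan_mono (h : L ⊆ L') : multSpan B p l L ≤ multSpan B p l L' := by
  refine Submodule.span_mono ?_
  rintro x ⟨a, i, b, hL, rfl⟩
  exact ⟨a, i, b, h hL, rfl⟩

variable [LinearOrder W] [MulLeftStrictMono W] [MulRightStrictMono W]

/-- The order is strictly compatible with multiplication on both sides, so passing from `p i` to a
multiple keeps the leading coefficient `1` and moves the leading word accordingly. -/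
theorem mult_sub_mem (hB : ∀ u v, B (u * v) = B u * B v)
    (hp : ∀ i, p i - B (l i) ∈ wordSpan B (Set.Iio (l i))) (a b : W) (i : ι) :
    B a * p i * B b - B (a * l i * b) ∈ wordSpan B (Set.Iio (a * l i * b)) := by
  rw [hB, hB, ← sub_mul, ← mul_sub]
  refine mul_mem_of_mem_wordSpan (fun w hw => ?_) (hp i)
  rw [← hB, ← hB]
  exact basis_mem_wordSpan (mul_lt_mul_left (mul_lt_mul_right hw a) b)

theorem multSpan_le_wordSpan (hB : ∀ u v, B (u * v) = B u * B v)
    (hp : ∀ i, p i - B (l i) ∈ wordSpan B (Set.Iio (l i))) (hL : IsLowerSet L) :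
    multSpan B p l L ≤ wordSpan B L := by
  refine Submodule.span_le.2 ?_
  rintro _ ⟨a, i, b, h, rfl⟩
  have h1 := wordSpan_mono (B := B) (fun w hw => hL (le_of_lt hw) h) (mult_sub_mem hB hp a b i)
  simpa using add_mem h1 (basis_mem_wordSpan h)

/-- Two multiples of relations with disjoint leading factors and the same leading word agree modulo
multiples with smaller leading words. -/
theorem disjoint_overlap_mem (hB : ∀ u v, B (u * v) = B u * B v)
    (hp : ∀ i, p i - B (l i) ∈ wordSpan B (Set.Iio (l i))) (a c b : W) (i j : ι) :
    B a * p i * B (c * l j * b) - B (a * l i * c) * p j * B b ∈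
      multSpan B p l (Set.Iio (a * l i * c * l j * b)) := by
  -- Both products are compared with `a p_i c p_j b`: each differs from it by a term in which one
  -- relation is replaced by its lower part.
  have e : B a * p i * B (c * l j * b) - B (a * l i * c) * p j * B b =
      (B a * (p i - B (l i)) * (B c * p j * B b)) -
      (B a * p i * B c) * (p j - B (l j)) * B b := by
    simp only [hB]; noncomm_ring
  rw [e]
  refine sub_mem ?_ ?_
  · refine mul_mem_of_mem_wordSpan (fun w hw => ?_) (hp i)
    have : B a * B w * (B c * p j * B b) = B (a * w * c) * p j * B b := by
      simp only [hB, mul_assoc]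
    rw [this]
    refine mult_mem_multSpan ?_
    have := mul_lt_mul_left (mul_lt_mul_left (mul_lt_mul_left (mul_lt_mul_right hw a) c) (l j)) b
    exact this
  · refine mul_mem_of_mem_wordSpan (fun w hw => ?_) (hp j)
    have : B a * p i * B c * B w * B b = B a * p i * B (c * w * b) := by
      simp only [hB, mul_assoc]
    rw [this]
    refine mult_mem_multSpan ?_
    have := mul_lt_mul_left (mul_lt_mul_right hw (a * l i * c)) b
    simpa only [mul_assoc, Set.mem_Iio] using this

/-- **Diamond lemma.** If the ambiguities are resolvable, then an element of the ideal which only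
involves words of a lower set `L` is a combination of multiples of the relations with leading
words in `L`. -/
theorem mem_multSpan_of_mem_wordSpan [WellFoundedLT W] (hB : ∀ u v, B (u * v) = B u * B v)
    (hp : ∀ i, p i - B (l i) ∈ wordSpan B (Set.Iio (l i)))
    (hres : ∀ a i b a' j b', a * l i * b = a' * l j * b' →
      B a * p i * B b - B a' * p j * B b' ∈ multSpan B p l (Set.Iio (a * l i * b)))
    (hL : IsLowerSet L) {x : A} (hx : x ∈ multSpan B p l Set.univ) (hxL : x ∈ wordSpan B L) :
    x ∈ multSpan B p l L := by
  classical
  -- A combination has finitely many terms, hence a largest leading word; this bound makes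
  -- well-founded induction possible.
  have hdir : ∀ S : Set W, S.Nonempty → IsLowerSet S → ∀ y ∈ multSpan B p l S,
      ∃ v ∈ S, y ∈ multSpan B p l (Set.Iic v) := by
    intro S ⟨v₀, hv₀⟩ hS y hy
    induction hy using Submodule.span_induction with
    | mem y hy =>
      obtain ⟨a, i, b, h, rfl⟩ := hy
      exact ⟨_, h, mult_mem_multSpan (Set.mem_Iic.2 le_rfl)⟩
    | zero => exact ⟨v₀, hv₀, zero_mem _⟩
    | add y z _ _ hy hz =>
      obtain ⟨v, hv, hy⟩ := hy
      obtain ⟨v', hv', hz⟩ := hz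
      rcases le_total v v' with h | h
      · exact ⟨v', hv', add_mem (multSpan_mono (Set.Iic_subset_Iic.2 h) hy) hz⟩
      · exact ⟨v, hv, add_mem hy (multSpan_mono (Set.Iic_subset_Iic.2 h) hz)⟩
    | smul c y _ hy =>
      obtain ⟨v, hv, hy⟩ := hy
      exact ⟨v, hv, Submodule.smul_mem _ _ hy⟩
  -- Induction on the bound `v`. If `v ∉ L`, the terms with leading word `v` collapse to one by
  -- `hres`; its coefficient is that of `v` in `x`, which is zero, so the bound drops.
  have key : ∀ v : W, ∀ x ∈ multSpan B p l (Set.Iic v), x ∈ wordSpan B L →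
      x ∈ multSpan B p l L := by
    intro v
    induction v using WellFoundedLT.induction with
    | ind v ih =>
      intro x hx hxL
      by_cases hv : v ∈ L
      · exact multSpan_mono (fun w hw => hL hw hv) hx
      have hlt : x ∈ multSpan B p l (Set.Iio v) := by
        by_cases hex : ∃ a i b, a * l i * b = v
        · obtain ⟨a, i, b, hab⟩ := hex
          have hle : multSpan B p l (Set.Iic v) ≤
              multSpan B p l (Set.Iio v) ⊔ Submodule.span K {B a * p i * B b} := by
            refine Submodule.span_le.2 ?_
            rintro _ ⟨a', j, b', h, rfl⟩
            rcases lt_or_eq_of_le (Set.mem_Iic.1 h) with h | h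
            · exact Submodule.mem_sup_left (mult_mem_multSpan h)
            · have h1 := hres a' j b' a i b (h.trans hab.symm)
              rw [h] at h1
              have := add_mem (Submodule.mem_sup_left (T := Submodule.span K {B a * p i * B b}) h1)
                (Submodule.mem_sup_right (Submodule.mem_span_singleton_self _))
              simpa using this
          obtain ⟨y, hy, z, hz, rfl⟩ := Submodule.mem_sup.1 (hle hx)
          obtain ⟨c, rfl⟩ := Submodule.mem_span_singleton.1 hz
          have h1 : B.repr (y + c • (B a * p i * B b)) v = 0 :=
            repr_eq_zero_of_mem_wordSpan hxL hv
          have h2 : B.repr y v = 0 := repr_eq_zero_of_mem_wordSpan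
            (multSpan_le_wordSpan hB hp (isLowerSet_Iio v) hy) (by simp)
          have h3 : B.repr (B a * p i * B b) v = 1 := by
            have := repr_eq_zero_of_mem_wordSpan (mult_sub_mem hB hp a b i) (w := v) (by simp [hab])
            rw [hab, map_sub, Finsupp.sub_apply, sub_eq_zero] at this
            simpa using this
          rw [map_add, map_smul, Finsupp.add_apply, Finsupp.smul_apply, h2, h3] at h1
          have hc : c = 0 := by simpa using h1
          simpa [hc] using hy
        · refine multSpan_mono (L := Set.Iic v ∩ {w | ∃ a i b, a * l i * b = w}) ?_ ?_
          · rintro w ⟨hw, hw'⟩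
            exact lt_of_le_of_ne hw (by rintro rfl; exact hex hw')
          · refine (Submodule.span_mono ?_ :
              multSpan B p l (Set.Iic v) ≤ multSpan B p l _) hx
            rintro _ ⟨a, i, b, h, rfl⟩
            exact ⟨a, i, b, ⟨h, a, i, b, rfl⟩, rfl⟩
      rcases (Set.Iio v).eq_empty_or_nonempty with h0 | h0
      · exact multSpan_mono (by simp [h0]) hlt
      · obtain ⟨v', hv', hx'⟩ := hdir _ h0 (isLowerSet_Iio v) x hlt
        exact ih v' hv' x hx' hxL
  obtain ⟨v, -, hv⟩ := hdir Set.univ ⟨1, trivial⟩ isLowerSet_univ x hx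
  exact key v x hv hxL

end Diamond

/-! ### The shortlex order on words -/

section Words

/-- Equal length excludes the case of a proper prefix, where appending a word can reverse the order.
-/
theorem lex_append_right {X : Type*} {r : X → X → Prop} {u v : List X} (h : List.Lex r u v)
    (hl : u.length = v.length) (w : List X) : List.Lex r (u ++ w) (v ++ w) := by
  induction h with
  | nil => simp at hl
  | cons _ ih => exact .cons (ih (by simpa using hl))
  | rel h => exact .rel h

variable {X : Type*} [LinearOrder X]

/-- Words ordered by length, then lexicographically. -/
@[reducible] def wordOrder (X : Type*) [LinearOrder X] : LinearOrder (FreeMonoid X) :=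
  letI : DecidableRel (List.Shortlex (α := X) (· < ·)) := Classical.decRel _
  haveI : IsStrictTotalOrder (List X) (List.Shortlex (α := X) (· < ·)) :=
    { trichotomous := (List.Shortlex.trichotomous (r := ((· < ·) : X → X → Prop))).trichotomous
      irrefl := fun a h => (List.Shortlex.asymm (r := ((· < ·) : X → X → Prop))).asymm a a h h
      trans := fun a b c hab hbc => by
        rcases List.shortlex_def.1 hab with h | ⟨h, h'⟩ <;>
          rcases List.shortlex_def.1 hbc with k | ⟨k, k'⟩
        · exact .of_length_lt (h.trans k)
        · exact .of_length_lt (k ▸ h)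
        · exact .of_length_lt (h ▸ k)
        · exact .of_lex (h.trans k) (List.lt_trans (α := X) h' k') }
  linearOrderOfSTO (α := List X) (List.Shortlex (α := X) (· < ·))

attribute [local instance] wordOrder

theorem word_lt_of_length_lt {u v : FreeMonoid X} (h : u.length < v.length) : u < v :=
  List.Shortlex.of_length_lt h

theorem length_le_of_word_le {u v : FreeMonoid X} (h : u ≤ v) : u.length ≤ v.length := by
  by_contra hlt
  exact absurd (word_lt_of_length_lt (not_le.1 hlt)) (not_lt.2 h)

instance wordMulLeft : MulLeftStrictMono (FreeMonoid X) :=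
  ⟨fun w _ _ h => List.Shortlex.append_left h w.toList⟩

instance wordMulRight : MulRightStrictMono (FreeMonoid X) :=
  ⟨fun w u v h => by
    rcases List.shortlex_def.1 h with h | ⟨h, h'⟩
    · refine List.Shortlex.of_length_lt (s := u.toList ++ w.toList) (t := v.toList ++ w.toList) ?_
      simp only [List.length_append]
      exact Nat.add_lt_add_right h _
    · refine List.Shortlex.of_lex (s := u.toList ++ w.toList) (t := v.toList ++ w.toList) ?_
        (lex_append_right h' h w.toList)
      simp only [List.length_append]
      exact congrArg (· + _) h⟩

instance wordWellFounded [WellFoundedLT X] : WellFoundedLT (FreeMonoid X) :=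
  ⟨List.Shortlex.wf (IsWellFounded.wf : WellFounded ((· < ·) : X → X → Prop))⟩

/-- Comparing lengths first makes the filtration by degree consist of lower sets, to which the
diamond lemma applies. -/
theorem isLowerSet_length_le (n : ℕ) : IsLowerSet {w : FreeMonoid X | w.length ≤ n} :=
  fun _ _ h h' => (length_le_of_word_le h).trans h'

theorem word_lt_of_lex {u v : FreeMonoid X} (h : u.length = v.length)
    (h' : List.Lex (· < ·) u.toList v.toList) : u < v :=
  List.Shortlex.of_lex h h'

theorem of_mul_lt_of_mul {x y : X} (h : x < y) {u v : FreeMonoid X} (hl : u.length = v.length) :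
    FreeMonoid.of x * u < FreeMonoid.of y * v :=
  word_lt_of_lex (congrArg (· + 1) hl) (List.Lex.rel h)

theorem of_mul_lt_of_mul_left {x : X} {u v : FreeMonoid X} (h : u < v) :
    FreeMonoid.of x * u < FreeMonoid.of x * v :=
  mul_lt_mul_right h _

end Words

/-! ### Deformations of a central diagonal quadratic form -/

section DiagonalForm

open FreeMonoid (of)

attribute [local instance] wordOrder

variable {K A X : Type*} [Field K] [Ring A] [Algebra K A] [LinearOrder X]

/-- The relation `[∑ a_m e_m², e_k] - J_k`. -/
def diagRel [Fintype X] (B : Module.Basis (FreeMonoid X) K A) (a : X → K) (J : X → A) (k : X) : A :=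
  ∑ m, a m • (B (of m * of m * of k) - B (of k * of m * of m)) - J k

/-- The leading words of the relations `diagRel`, `t` being the largest letter and `u` the
second largest one. -/
def diagLead (t u k : X) : FreeMonoid X :=
  if k = t then of t * of u * of u else of t * of t * of k

/-- The relations `diagRel`, with leading coefficients `1`. -/
def monicRel [Fintype X] (B : Module.Basis (FreeMonoid X) K A) (a : X → K) (J : X → A) (t u k : X) : A :=
  if k = t then -(a u)⁻¹ • diagRel B a J k else (a t)⁻¹ • diagRel B a J k

variable {B : Module.Basis (FreeMonoid X) K A} {a : X → K} {J : X → A} {t u : X}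

theorem length_diagLead (k : X) : (diagLead t u k).length = 3 := by
  unfold diagLead
  split_ifs <;> rfl

theorem mul_mem_multSpan_Iio (hB : ∀ v w, B (v * w) = B v * B w) {p : X → A}
    {l : X → FreeMonoid X} {w : FreeMonoid X} (c : FreeMonoid X) {x : A}
    (hx : x ∈ multSpan B p l (Set.Iio w)) : B c * x ∈ multSpan B p l (Set.Iio (c * w)) := by
  have : multSpan B p l (Set.Iio w) ≤
      (multSpan B p l (Set.Iio (c * w))).comap (LinearMap.mulLeft K (B c)) := by
    refine Submodule.span_le.2 ?_
    rintro _ ⟨a, i, b, h, rfl⟩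
    have e : B c * (B a * p i * B b) = B (c * a) * p i * B b := by simp only [hB, mul_assoc]
    simp only [Submodule.comap_coe, Set.mem_preimage, LinearMap.mulLeft_apply, SetLike.mem_coe, e]
    refine mult_mem_multSpan ?_
    simpa only [mul_assoc, Set.mem_Iio] using mul_lt_mul_right (Set.mem_Iio.1 h) c
  exact this hx

/-- The words are `ttk` with `k ≠ t`, and `tuu`. None ends in `t`, while all begin with `t`, so no
overlap has length one. An overlap of length two needs a word whose second letter is `t`, hence some
`ttk`, and a word beginning with `tk`, which forces `tuu` and `k = u`. -/
theorem diagLead_overlap (hut : u ≠ t) {c v w : FreeMonoid X} {i j : X}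
    (h : diagLead t u i * v = c * (diagLead t u j * w)) :
    (c = 1 ∧ i = j ∧ v = w) ∨ (∃ c', c = diagLead t u i * c' ∧ v = c' * (diagLead t u j * w)) ∨
      (c = of t ∧ i = u ∧ j = t ∧ v = of u * w) := by
  -- The cases are the lengths 0, 1, 2 and at least 3 of the shift `c` between the two occurrences.
  have key : ∀ (x y z x' y' z' : X) (c v w : List X),
      x :: y :: z :: v = c ++ x' :: y' :: z' :: w →
      (c = [] ∧ x = x' ∧ y = y' ∧ z = z' ∧ v = w) ∨
      (c = [x] ∧ y = x' ∧ z = y' ∧ v = z' :: w) ∨ (c = [x, y] ∧ z = x') ∨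
      ∃ c', c = x :: y :: z :: c' ∧ v = c' ++ x' :: y' :: z' :: w := by
    intro x y z x' y' z' c v w h
    rcases c with _ | ⟨c₁, _ | ⟨c₂, _ | ⟨c₃, c⟩⟩⟩ <;> simp_all
  have hij : ∀ x y z x' y' z', diagLead t u i = of x * of y * of z →
      diagLead t u j = of x' * of y' * of z' →
      (c = 1 ∧ x = x' ∧ y = y' ∧ z = z' ∧ v = w) ∨
      (c = of x ∧ y = x' ∧ z = y' ∧ v = of z' * w) ∨ (c = of x * of y ∧ z = x') ∨
      ∃ c', c = diagLead t u i * c' ∧ v = c' * (diagLead t u j * w) := by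
    intro x y z x' y' z' hi hj
    rw [hi, hj] at h ⊢
    exact key x y z x' y' z' c.toList v.toList w.toList h
  by_cases hi : i = t <;> by_cases hj : j = t
  · have := hij t u u t u u (by simp [diagLead, hi]) (by simp [diagLead, hj])
    grind
  · have := hij t u u t t j (by simp [diagLead, hi]) (by simp [diagLead, hj])
    grind
  · have := hij t t i t u u (by simp [diagLead, hi]) (by simp [diagLead, hj])
    grind
  · have := hij t t i t t j (by simp [diagLead, hi]) (by simp [diagLead, hj])
    grind

variable [Fintype X]

/-- The cubic words are `mmk` and `kmm`; for `k ≠ t` only `ttk` begins with the largest letter. -/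
theorem diagRel_sub_mem (hJ : ∀ k, J k ∈ wordSpan B {w | w.length ≤ 2}) (ht : ∀ k, k ≠ t → k < t)
    {k : X} (hk : k ≠ t) :
    diagRel B a J k - a t • B (of t * of t * of k) ∈
      wordSpan B (Set.Iio (of t * of t * of k)) := by
  have e : diagRel B a J k - a t • B (of t * of t * of k) =
      ∑ m, (a m • (B (of m * of m * of k) - B (of k * of m * of m)) -
        if m = t then a t • B (of t * of t * of k) else 0) - J k := by
    simp [diagRel, Finset.sum_sub_distrib]
    abel
  rw [e]
  refine sub_mem (sum_mem fun m _ => ?_) (wordSpan_mono (fun w hw => ?_) (hJ k))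
  · have h2 : B (of k * of m * of m) ∈ wordSpan B (Set.Iio (of t * of t * of k)) := by
      refine basis_mem_wordSpan ?_
      simp only [mul_assoc]
      exact of_mul_lt_of_mul (ht k hk) rfl
    by_cases hm : m = t
    · subst hm
      simp only [if_true, smul_sub]
      rw [sub_right_comm, sub_self, zero_sub]
      exact neg_mem (Submodule.smul_mem _ _ h2)
    · simp only [hm, if_false, sub_zero]
      refine Submodule.smul_mem _ _ (sub_mem (basis_mem_wordSpan ?_) h2)
      simp only [mul_assoc]
      exact of_mul_lt_of_mul (ht m hm) rfl
  · exact word_lt_of_length_lt (lt_of_le_of_lt hw (by decide : 2 < 3))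

/-- For `k = t` the two words `ttt` cancel. The remaining words beginning with `t` are `tmm`, `m ≠
t`, with coefficient `-a m`; the largest is `tuu`, which explains the sign. -/
theorem diagRel_add_mem (hJ : ∀ k, J k ∈ wordSpan B {w | w.length ≤ 2}) (ht : ∀ k, k ≠ t → k < t)
    (hut : u ≠ t) (hu : ∀ k, k ≠ t → k ≠ u → k < u) :
    diagRel B a J t + a u • B (of t * of u * of u) ∈
      wordSpan B (Set.Iio (of t * of u * of u)) := by
  have e : diagRel B a J t + a u • B (of t * of u * of u) =
      ∑ m, (a m • (B (of m * of m * of t) - B (of t * of m * of m)) +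
        if m = u then a u • B (of t * of u * of u) else 0) - J t := by
    simp [diagRel, Finset.sum_add_distrib]
    abel
  rw [e]
  refine sub_mem (sum_mem fun m _ => ?_) (wordSpan_mono (fun w hw => ?_) (hJ t))
  · by_cases hmt : m = t
    · subst hmt
      simp [hut.symm]
    have h1 : B (of m * of m * of t) ∈ wordSpan B (Set.Iio (of t * of u * of u)) := by
      refine basis_mem_wordSpan ?_
      simp only [mul_assoc]
      exact of_mul_lt_of_mul (ht m hmt) rfl
    by_cases hm : m = u
    · subst hm
      simp only [if_true, smul_sub, sub_add_cancel]
      exact Submodule.smul_mem _ _ h1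
    · simp only [hm, if_false, add_zero]
      refine Submodule.smul_mem _ _ (sub_mem h1 (basis_mem_wordSpan ?_))
      simp only [mul_assoc]
      exact of_mul_lt_of_mul_left (of_mul_lt_of_mul (hu m hmt hm) rfl)
  · exact word_lt_of_length_lt (lt_of_le_of_lt hw (by decide : 2 < 3))

theorem monicRel_sub_mem (ha : ∀ k, a k ≠ 0) (hJ : ∀ k, J k ∈ wordSpan B {w | w.length ≤ 2})
    (ht : ∀ k, k ≠ t → k < t) (hut : u ≠ t) (hu : ∀ k, k ≠ t → k ≠ u → k < u) (k : X) :
    monicRel B a J t u k - B (diagLead t u k) ∈ wordSpan B (Set.Iio (diagLead t u k)) := by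
  unfold monicRel diagLead
  split_ifs with hk
  · subst hk
    have := Submodule.smul_mem _ (-(a u)⁻¹) (diagRel_add_mem (a := a) hJ ht hut hu)
    rwa [smul_add, smul_smul, neg_mul, inv_mul_cancel₀ (ha u), neg_one_smul,
      ← sub_eq_add_neg] at this
  · have := Submodule.smul_mem _ (a t)⁻¹ (diagRel_sub_mem (a := a) hJ ht hk)
    rwa [smul_sub, smul_smul, inv_mul_cancel₀ (ha t), one_smul] at this

theorem diagRel_mult_mem (ha : ∀ k, a k ≠ 0) {L : Set (FreeMonoid X)} {v w : FreeMonoid X} {k : X}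
    (h : v * diagLead t u k * w ∈ L) :
    B v * diagRel B a J k * B w ∈ multSpan B (monicRel B a J t u) (diagLead t u) L := by
  have e : diagRel B a J k = (if k = t then -a u else a t) • monicRel B a J t u k := by
    unfold monicRel
    split_ifs
    · rw [smul_smul, neg_mul_neg, mul_inv_cancel₀ (ha u), one_smul]
    · rw [smul_smul, mul_inv_cancel₀ (ha t), one_smul]
  rw [e, mul_smul_comm, smul_mul_assoc]
  exact Submodule.smul_mem _ _ (mult_mem_multSpan h)

/-- The only ambiguity of the leading words is `ttuu`; it is resolvable. -/
theorem ttuu_mem (hB : ∀ v w, B (v * w) = B v * B w) (ha : ∀ k, a k ≠ 0)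
    (ht : ∀ k, k ≠ t → k < t) (hut : u ≠ t) (hu : ∀ k, k ≠ t → k ≠ u → k < u)
    (hsyz : ∑ k, a k • (B (of k) * diagRel B a J k + diagRel B a J k * B (of k)) ∈
      Submodule.span K (Set.range (diagRel B a J))) (w : FreeMonoid X) :
    monicRel B a J t u u * B (of u * w) - B (of t) * monicRel B a J t u t * B w ∈
      multSpan B (monicRel B a J t u) (diagLead t u)
        (Set.Iio (of t * of t * of u * (of u * w))) := by
  classical
  set M := multSpan B (monicRel B a J t u) (diagLead t u)
    (Set.Iio (of t * of t * of u * (of u * w))) with hM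
  set p := diagRel B a J with hp
  have e1 : monicRel B a J t u u * B (of u * w) - B (of t) * monicRel B a J t u t * B w =
      ((a t)⁻¹ * (a u)⁻¹) • ((a u • (p u * B (of u)) + a t • (B (of t) * p t)) * B w) := by
    have hau := ha u
    have hat := ha t
    simp only [monicRel, hut, if_false, if_true, hB, ← hp, add_mul, smul_add, smul_mul_assoc,
      smul_smul, mul_smul_comm, mul_assoc, neg_smul, mul_neg, neg_mul, sub_neg_eq_add]
    congr 2 <;> field_simp
  -- These are the two terms of the syzygy with leading word `ttuu`. The others are smaller: `e_k
  -- p_k` begins with `k < t` when `k ≠ t`, `p_t e_t` has leading word `tuut`, and `p_k e_k` has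
  -- `ttkk` with `k < u`.
  have e2 : a u • (p u * B (of u)) + a t • (B (of t) * p t) =
      ∑ k, a k • (B (of k) * p k + p k * B (of k)) -
        ∑ k, (if k = t then 0 else a k • (B (of k) * p k)) -
        ∑ k, (if k = u then 0 else a k • (p k * B (of k))) := by
    rw [← Finset.sum_sub_distrib, ← Finset.sum_sub_distrib]
    have h1 : a u • (p u * B (of u)) = ∑ k, if k = u then a k • (p k * B (of k)) else 0 := by simp
    have h2 : a t • (B (of t) * p t) = ∑ k, if k = t then a k • (B (of k) * p k) else 0 := by simp
    rw [h1, h2, ← Finset.sum_add_distrib]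
    refine Finset.sum_congr rfl fun k _ => ?_
    split_ifs <;> simp [smul_add, add_comm]
  rw [e1, e2]
  refine Submodule.smul_mem _ _ ?_
  rw [sub_mul, sub_mul]
  refine sub_mem (sub_mem ?_ ?_) ?_
  -- The whole syzygy sum is a combination of the relations themselves, whose leading words have
  -- length 3 and not 4.
  · have hle : Submodule.span K (Set.range p) ≤ M.comap (LinearMap.mulRight K (B w)) := by
      refine Submodule.span_le.2 ?_
      rintro _ ⟨k, rfl⟩
      have : p k * B w = B 1 * p k * B w := by rw [basis_one hB, one_mul]
      simp only [Submodule.comap_coe, Set.mem_preimage, LinearMap.mulRight_apply, SetLike.mem_coe,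
        this]
      refine diagRel_mult_mem ha (word_lt_of_length_lt ?_)
      simp [length_diagLead]
    exact hle hsyz
  · rw [Finset.sum_mul]
    refine sum_mem fun k _ => ?_
    split_ifs with hk
    · simp
    · rw [smul_mul_assoc]
      refine Submodule.smul_mem _ _ (diagRel_mult_mem ha ?_)
      simp only [diagLead, hk, if_false, mul_assoc]
      exact of_mul_lt_of_mul (ht k hk) (by simp)
  · rw [Finset.sum_mul]
    refine sum_mem fun k _ => ?_
    split_ifs with hk
    · simp
    · have e : a k • (p k * B (of k)) * B w = a k • (B 1 * p k * B (of k * w)) := by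
        rw [basis_one hB, one_mul, smul_mul_assoc, hB, mul_assoc]
      rw [e]
      refine Submodule.smul_mem _ _ (diagRel_mult_mem ha ?_)
      by_cases hkt : k = t
      · subst hkt
        simp only [diagLead, if_true, mul_assoc, one_mul]
        exact of_mul_lt_of_mul_left (of_mul_lt_of_mul (ht u hut) (by simp))
      · simp only [diagLead, hkt, if_false, mul_assoc, one_mul]
        exact of_mul_lt_of_mul_left (of_mul_lt_of_mul_left (of_mul_lt_of_mul (hu k hkt hk) (by simp)))

theorem ambiguity_mem (hB : ∀ v w, B (v * w) = B v * B w) (ha : ∀ k, a k ≠ 0)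
    (hJ : ∀ k, J k ∈ wordSpan B {w | w.length ≤ 2})
    (ht : ∀ k, k ≠ t → k < t) (hut : u ≠ t) (hu : ∀ k, k ≠ t → k ≠ u → k < u)
    (hsyz : ∑ k, a k • (B (of k) * diagRel B a J k + diagRel B a J k * B (of k)) ∈
      Submodule.span K (Set.range (diagRel B a J))) (c v w : FreeMonoid X) (i j : X)
    (h : diagLead t u i * v = c * (diagLead t u j * w)) :
    monicRel B a J t u i * B v - B c * monicRel B a J t u j * B w ∈
      multSpan B (monicRel B a J t u) (diagLead t u) (Set.Iio (diagLead t u i * v)) := by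
  rcases diagLead_overlap hut h with ⟨rfl, rfl, rfl⟩ | ⟨c', rfl, rfl⟩ | ⟨rfl, rfl, rfl, rfl⟩
  · simp [basis_one hB]
  · have := disjoint_overlap_mem hB (monicRel_sub_mem ha hJ ht hut hu) 1 c' w i j
    simpa only [basis_one hB, one_mul, mul_assoc] using this
  · have := ttuu_mem hB ha ht hut hu hsyz w
    simpa only [diagLead, hut, if_false] using this

/-- Modulo deformations of the relations `[q, e_k] = 0`, `q` a diagonal quadratic form in at least
two variables, there are no unexpected relations in low degree. -/
theorem mem_multSpan_diag [WellFoundedLT X] (hB : ∀ v w, B (v * w) = B v * B w)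
    (ha : ∀ k, a k ≠ 0) (hJ : ∀ k, J k ∈ wordSpan B {w | w.length ≤ 2})
    (ht : ∀ k, k ≠ t → k < t) (hut : u ≠ t) (hu : ∀ k, k ≠ t → k ≠ u → k < u)
    (hsyz : ∑ k, a k • (B (of k) * diagRel B a J k + diagRel B a J k * B (of k)) ∈
      Submodule.span K (Set.range (diagRel B a J))) {n : ℕ} {x : A}
    (hx : x ∈ Submodule.span K {x | ∃ v k w, x = B v * diagRel B a J k * B w})
    (hxn : x ∈ wordSpan B {w | w.length ≤ n}) :
    x ∈ Submodule.span K {x | ∃ v k w, v.length + 3 + w.length ≤ n ∧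
      x = B v * diagRel B a J k * B w} := by
  have hx' : x ∈ multSpan B (monicRel B a J t u) (diagLead t u) Set.univ := by
    refine (Submodule.span_le.2 ?_ : _ ≤ multSpan B _ _ _) hx
    rintro _ ⟨v, k, w, rfl⟩
    exact diagRel_mult_mem ha trivial
  have hres : ∀ c i v c' j w, c * diagLead t u i * v = c' * diagLead t u j * w →
      B c * monicRel B a J t u i * B v - B c' * monicRel B a J t u j * B w ∈
        multSpan B (monicRel B a J t u) (diagLead t u) (Set.Iio (c * diagLead t u i * v)) := by
    -- It suffices to treat two multiples one of whose left factors is a prefix of the other; the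
    -- common prefix is then stripped off.
    have key : ∀ c i v d j w, diagLead t u i * v = d * (diagLead t u j * w) →
        B c * monicRel B a J t u i * B v - B (c * d) * monicRel B a J t u j * B w ∈
          multSpan B (monicRel B a J t u) (diagLead t u) (Set.Iio (c * diagLead t u i * v)) := by
      intro c i v d j w h
      have := mul_mem_multSpan_Iio hB c (ambiguity_mem hB ha hJ ht hut hu hsyz d v w i j h)
      simpa only [hB, mul_sub, mul_assoc] using this
    intro c i v c' j w h
    have h' : c.toList ++ ((diagLead t u i).toList ++ v.toList) =
        c'.toList ++ ((diagLead t u j).toList ++ w.toList) := by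
      rw [mul_assoc, mul_assoc] at h
      exact h
    rcases List.append_eq_append_iff.1 h' with ⟨d, hd, h1⟩ | ⟨d, hd, h1⟩
    · obtain rfl : c' = c * FreeMonoid.ofList d := hd
      exact key c i v _ j w h1
    · obtain rfl : c = c' * FreeMonoid.ofList d := hd
      rw [h, ← neg_sub]
      exact neg_mem (key c' j w _ i v h1)
  have h := mem_multSpan_of_mem_wordSpan hB (monicRel_sub_mem ha hJ ht hut hu) hres
    (isLowerSet_length_le n) hx' hxn
  refine (Submodule.span_le.2 ?_ : multSpan B _ _ _ ≤ _) h
  rintro _ ⟨v, k, w, hl, rfl⟩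
  have hl' : v.length + 3 + w.length ≤ n := by
    simpa [FreeMonoid.length_mul, length_diagLead] using hl
  have hmem := Submodule.subset_span (R := K) (show B v * diagRel B a J k * B w ∈
    {x | ∃ v k w, v.length + 3 + w.length ≤ n ∧ x = B v * diagRel B a J k * B w} from
      ⟨v, k, w, hl', rfl⟩)
  unfold monicRel
  split_ifs
  all_goals
    rw [mul_smul_comm, smul_mul_assoc]
    exact Submodule.smul_mem _ _ hmem

end DiagonalForm

/-! ### The tensor algebra and its words -/

section TensorWords

open FreeMonoid (of)

variable {K : Type*} [Field K] {V : Type*} [AddCommGroup V] [Module K V] {X : Type*}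

theorem tensorAlgebra_basis_mul (b : Module.Basis X K V) (v w : FreeMonoid X) :
    b.tensorAlgebra (v * w) = b.tensorAlgebra v * b.tensorAlgebra w := by
  simp only [Module.Basis.tensorAlgebra, Module.Basis.map_apply, FreeAlgebra.basisFreeMonoid]
  simp [← map_mul, MonoidAlgebra.single_mul_single]

theorem tensorAlgebra_basis_of (b : Module.Basis X K V) (x : X) :
    b.tensorAlgebra (of x) = TensorAlgebra.ι K (b x) := by
  simp only [Module.Basis.tensorAlgebra, Module.Basis.map_apply, FreeAlgebra.basisFreeMonoid]
  simp [FreeAlgebra.equivMonoidAlgebraFreeMonoid]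

theorem mem_of_forall_basis {B : Module.Basis X K V} {M : Submodule K V} (h : ∀ x, B x ∈ M)
    (v : V) : v ∈ M := by
  have : Submodule.span K (Set.range B) ≤ M := Submodule.span_le.2 (by rintro _ ⟨x, rfl⟩; exact h x)
  exact this (B.mem_span v)

theorem tens_le_wordSpan (b : Module.Basis X K V) (n : ℕ) :
    tens K V n ≤ wordSpan b.tensorAlgebra {w | w.length = n} := by
  induction n with
  | zero =>
    rw [tens, pow_zero, Submodule.one_le, ← basis_one (tensorAlgebra_basis_mul b)]
    exact basis_mem_wordSpan rfl
  | succ n ih =>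
    rw [tens, pow_succ, Submodule.mul_le]
    rintro x hx _ ⟨v, rfl⟩
    have key : ∀ w : FreeMonoid X, w.length = n → b.tensorAlgebra w * TensorAlgebra.ι K v ∈
        wordSpan b.tensorAlgebra {w | w.length = n + 1} := by
      intro w hw
      refine mem_of_forall_basis (B := b) (M := (wordSpan b.tensorAlgebra {w | w.length = n + 1}).comap
        (LinearMap.mulLeft K (b.tensorAlgebra w) ∘ₗ TensorAlgebra.ι K)) (fun x => ?_) v
      have : b.tensorAlgebra w * TensorAlgebra.ι K (b x) = b.tensorAlgebra (w * of x) := by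
        rw [tensorAlgebra_basis_mul, tensorAlgebra_basis_of]
      simp only [Submodule.mem_comap, LinearMap.comp_apply, LinearMap.mulLeft_apply, this]
      refine basis_mem_wordSpan ?_
      simp [FreeMonoid.length_mul, hw]
    have := mul_mem_of_mem_wordSpan (B := b.tensorAlgebra) (a := 1) (b := TensorAlgebra.ι K v)
      (M := wordSpan b.tensorAlgebra {w | w.length = n + 1}) (fun w hw => by
        rw [one_mul]; exact key w hw) (ih hx)
    simpa using this

theorem filt_le_wordSpan (b : Module.Basis X K V) (n : ℕ) :
    filt K V n ≤ wordSpan b.tensorAlgebra {w | w.length ≤ n} :=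
  iSup₂_le fun i hi => (tens_le_wordSpan b i).trans
    (wordSpan_mono fun _ hw => (le_of_eq hw).trans hi)

theorem tensorAlgebra_basis_mem (b : Module.Basis X K V) (w : FreeMonoid X) :
    b.tensorAlgebra w ∈ tens K V w.length := by
  induction w using FreeMonoid.inductionOn' with
  | one =>
    rw [basis_one (tensorAlgebra_basis_mul b)]
    exact SetLike.one_mem_graded _
  | of_mul x w ih =>
    rw [tensorAlgebra_basis_mul, FreeMonoid.length_mul]
    refine SetLike.mul_mem_graded ?_ ih
    simp [tensorAlgebra_basis_of, tens]

end TensorWords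

/-! ### The PBW property in terms of the ideal of relations -/

section Ideals

variable {K : Type*} [Field K] {V : Type*} [AddCommGroup V] [Module K V]

theorem smul_mem_relIdeal {P : Submodule K (TensorAlgebra K V)} (c : K) {x : TensorAlgebra K V}
    (hx : x ∈ relIdeal P) : c • x ∈ relIdeal P := by
  rw [Algebra.smul_def]
  exact (relIdeal P).mul_mem_left _ _ hx

theorem filtLT_le_filt (n : ℕ) : filtLT K V n ≤ filt K V n :=
  iSup₂_le fun i hi => le_iSup₂_of_le i hi.le le_rfl

theorem filt_eq_filtLT_succ (n : ℕ) : filt K V n = filtLT K V (n + 1) := by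
  simp only [filt, filtLT, Nat.lt_succ_iff]

theorem proj_eq_zero_of_mem_filtLT {n k : ℕ} (h : n ≤ k) {x : TensorAlgebra K V}
    (hx : x ∈ filtLT K V n) : proj K V k x = 0 := by
  have : filtLT K V n ≤ LinearMap.ker (proj K V k) :=
    iSup₂_le fun i hi y hy => proj_of_mem_ne hy (by omega)
  exact this hx

/-- Surjectivity of the canonical map is automatic, since an element of `F^n` has the class of its
component of degree `n`. Only injectivity remains, expressed by representatives in the tensor
algebra. -/
theorem hasPBW_iff {N : ℕ} {P : Submodule K (TensorAlgebra K V)} (hP : P ≤ filt K V N) :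
    HasPBW N P hP ↔ ∀ n, ∀ x ∈ tens K V n, ∀ y ∈ filtLT K V n, x - y ∈ relIdeal P →
      x ∈ relIdeal (homPart N P) := by
  have hgr : ∀ n (x : tens K V n), tensToGr P n x = 0 ↔
      ∃ y ∈ filtLT K V n, (x : TensorAlgebra K V) - y ∈ relIdeal P := by
    intro n x
    refine (Submodule.Quotient.mk_eq_zero _).trans ?_
    constructor
    · rintro ⟨y, hy, hxy⟩
      refine ⟨y, hy, ?_⟩
      rw [← toQuot_eq_zero_iff, map_sub, sub_eq_zero]
      exact hxy.symm
    · rintro ⟨y, hy, hxy⟩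
      rw [← toQuot_eq_zero_iff, map_sub, sub_eq_zero] at hxy
      exact ⟨y, hy, hxy.symm⟩
  have hdeg : ∀ n (x : tens K V n), tensToHomDeg N P n x = 0 ↔
      (x : TensorAlgebra K V) ∈ relIdeal (homPart N P) := by
    intro n x
    rw [← toQuot_eq_zero_iff]
    exact Subtype.ext_iff
  have hsurj : ∀ n, Function.Surjective (grMap N P hP n) := by
    intro n z
    obtain ⟨⟨_, x, hx, rfl⟩, rfl⟩ := Submodule.Quotient.mk_surjective _ z
    refine ⟨tensToHomDeg N P n ⟨proj K V n x, proj_mem n x⟩, ?_⟩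
    rw [grMap_apply]
    refine (Submodule.Quotient.eq _).2 ?_
    refine ⟨-(x - proj K V n x), neg_mem (sub_proj_mem hx), ?_⟩
    simp only [map_sub, neg_sub]
    rfl
  constructor
  · intro h n x hx y hy hxy
    have := (hgr n ⟨x, hx⟩).2 ⟨y, hy, hxy⟩
    rw [← grMap_apply N P hP, map_eq_zero_iff _ (h n).1] at this
    exact (hdeg n ⟨x, hx⟩).1 this
  · intro h n
    refine ⟨(injective_iff_map_eq_zero _).2 fun z hz => ?_, hsurj n⟩
    obtain ⟨x, rfl⟩ := tensToHomDeg_surjective N P n z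
    rw [grMap_apply, hgr] at hz
    obtain ⟨y, hy, hxy⟩ := hz
    exact (hdeg n x).2 (h n x x.2 y hy hxy)

/-- In degrees at most `N`, the ideal generated by `R = π(P) ⊆ V^{⊗N}` is concentrated in
degree `N`, where it is `R`. -/
theorem proj_mem_of_mem_relIdeal_homPart {N : ℕ} {P : Submodule K (TensorAlgebra K V)}
    {x : TensorAlgebra K V} (hx : x ∈ relIdeal (homPart N P)) {k : ℕ} (hk : k ≤ N) :
    proj K V k x ∈ if k = N then homPart N P else ⊥ := by
  have hscal : ∀ a ∈ tens K V 0, ∃ c : K, a = algebraMap K _ c := by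
    intro a ha
    rw [tens, pow_zero, Submodule.mem_one] at ha
    exact ha.imp fun _ h => h.symm
  induction hx using TwoSidedIdeal.span_induction generalizing k with
  | mem x hx =>
    obtain ⟨p, hp, rfl⟩ := hx
    split_ifs with h
    · subst h
      rw [proj_of_mem (proj_mem k p)]
      exact ⟨p, hp, rfl⟩
    · rw [proj_of_mem_ne (proj_mem N p) (Ne.symm h)]
      exact zero_mem _
  | zero => simp
  | add x y _ _ hx hy => rw [map_add]; exact add_mem (hx hk) (hy hk)
  | neg x _ hx => rw [map_neg]; exact neg_mem (hx hk)
  | left_absorb a x _ hx =>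
    induction a using DirectSum.Decomposition.inductionOn (tens K V) with
    | zero => simp
    | @homogeneous i a =>
      rw [proj_mul_left a.2]
      by_cases h : i ≤ k
      · rw [if_pos h]
        -- A factor of degree 0 is a scalar; one of positive degree leaves a component of `x` of
        -- degree below `N`, which vanishes.
        rcases Nat.eq_zero_or_pos i with rfl | hi
        · obtain ⟨c, hc⟩ := hscal a a.2
          rw [hc, ← Algebra.smul_def, Nat.sub_zero]
          exact Submodule.smul_mem _ _ (hx hk)
        · have := hx (k := k - i) (by omega)
          rw [if_neg (by omega), Submodule.mem_bot] at this
          rw [this, mul_zero]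
          exact zero_mem _
      · rw [if_neg h]
        exact zero_mem _
    | add a b ha hb => rw [add_mul, map_add]; exact add_mem ha hb
  | right_absorb a x _ hx =>
    induction a using DirectSum.Decomposition.inductionOn (tens K V) with
    | zero => simp
    | @homogeneous i a =>
      rw [proj_mul_right a.2]
      by_cases h : i ≤ k
      · rw [if_pos h]
        rcases Nat.eq_zero_or_pos i with rfl | hi
        · obtain ⟨c, hc⟩ := hscal a a.2
          rw [hc, ← Algebra.commutes, ← Algebra.smul_def, Nat.sub_zero]
          exact Submodule.smul_mem _ _ (hx hk)
        · have := hx (k := k - i) (by omega)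
          rw [if_neg (by omega), Submodule.mem_bot] at this
          rw [this, zero_mul]
          exact zero_mem _
      · rw [if_neg h]
        exact zero_mem _
    | add a b ha hb => rw [mul_add, map_add]; exact add_mem ha hb

/-- Under the PBW property, the ideal of the relations has no element of degree `< N`. -/
theorem eq_zero_of_mem_relIdeal {N : ℕ} {P : Submodule K (TensorAlgebra K V)}
    {hP : P ≤ filt K V N} (h : HasPBW N P hP) {n : ℕ} (hn : n ≤ N) {y : TensorAlgebra K V}
    (hy : y ∈ filtLT K V n) (hyP : y ∈ relIdeal P) : y = 0 := by
  induction n with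
  | zero =>
    have : filtLT K V 0 = ⊥ := by simp [filtLT]
    rwa [this, Submodule.mem_bot] at hy
  | succ n ih =>
    refine ih (by omega) ?_
    rw [← filt_eq_filtLT_succ] at hy
    have hlow := sub_proj_mem hy
    -- By PBW the top component of `y` lies in `(R)`, which is zero in degree `n < N`; so the degree
    -- of `y` drops.
    have h1 := (hasPBW_iff hP).1 h n (proj K V n y) (proj_mem n y) _ (neg_mem hlow)
      (by simpa using hyP)
    have h2 := proj_mem_of_mem_relIdeal_homPart h1 (k := n) (by omega)
    rw [if_neg (by omega), proj_of_mem (proj_mem n y), Submodule.mem_bot] at h2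
    rwa [h2, sub_zero] at hlow

theorem mem_span_of_mem_relIdeal {X ι : Type*} (b : Module.Basis X K V)
    {p : ι → TensorAlgebra K V} {x : TensorAlgebra K V}
    (hx : x ∈ relIdeal (Submodule.span K (Set.range p))) :
    x ∈ Submodule.span K {x | ∃ v k w, x = b.tensorAlgebra v * p k * b.tensorAlgebra w} := by
  have hB := tensorAlgebra_basis_mul b
  set M := Submodule.span K {x | ∃ v k w, x = b.tensorAlgebra v * p k * b.tensorAlgebra w} with hM
  induction hx using TwoSidedIdeal.span_induction with
  | mem x hx =>
    refine (Submodule.span_le.2 ?_ : Submodule.span K (Set.range p) ≤ M) hx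
    rintro _ ⟨k, rfl⟩
    exact Submodule.subset_span ⟨1, k, 1, by simp [basis_one hB]⟩
  | zero => exact zero_mem _
  | add x y _ _ hx hy => exact add_mem hx hy
  | neg x _ hx => exact neg_mem hx
  | left_absorb a x _ hx =>
    refine mem_of_forall_basis (B := b.tensorAlgebra) (M := M.comap (LinearMap.mulRight K x))
      (fun u => ?_) a
    have : M ≤ M.comap (LinearMap.mulLeft K (b.tensorAlgebra u)) := by
      refine Submodule.span_le.2 ?_
      rintro _ ⟨v, k, w, rfl⟩
      exact Submodule.subset_span ⟨u * v, k, w, by simp [hB, mul_assoc]⟩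
    exact this hx
  | right_absorb a x _ hx =>
    refine mem_of_forall_basis (B := b.tensorAlgebra) (M := M.comap (LinearMap.mulLeft K x))
      (fun u => ?_) a
    have : M ≤ M.comap (LinearMap.mulRight K (b.tensorAlgebra u)) := by
      refine Submodule.span_le.2 ?_
      rintro _ ⟨v, k, w, rfl⟩
      exact Submodule.subset_span ⟨v, k, w * u, by simp [hB, mul_assoc]⟩
    exact this hx

/-- The PBW property holds if elements of `(P)` of degree at most `n` are combinations of
multiples of the relations of degree at most `n`. -/
theorem hasPBW_of_mem_span {X ι : Type*} (b : Module.Basis X K V) {N : ℕ}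
    {p : ι → TensorAlgebra K V} (hP : Submodule.span K (Set.range p) ≤ filt K V N)
    (h : ∀ n, ∀ x ∈ filt K V n, x ∈ relIdeal (Submodule.span K (Set.range p)) →
      x ∈ Submodule.span K {x | ∃ v k w, v.length + N + w.length ≤ n ∧
        x = b.tensorAlgebra v * p k * b.tensorAlgebra w}) :
    HasPBW N (Submodule.span K (Set.range p)) hP := by
  refine (hasPBW_iff hP).2 fun n x hx y hy hxy => ?_
  have h1 := h n _ (sub_mem (tens_le_filt n hx) (filtLT_le_filt n hy)) hxy
  have h2 : ∀ z ∈ Submodule.span K {x | ∃ v k w, v.length + N + w.length ≤ n ∧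
        x = b.tensorAlgebra v * p k * b.tensorAlgebra w},
      proj K V n z ∈ relIdeal (homPart N (Submodule.span K (Set.range p))) := by
    intro z hz
    induction hz using Submodule.span_induction with
    | mem z hz =>
      obtain ⟨v, k, w, hl, rfl⟩ := hz
      have hpk : p k ∈ Submodule.span K (Set.range p) := Submodule.subset_span ⟨k, rfl⟩
      rw [proj_mul_right (tensorAlgebra_basis_mem b w), if_pos (by omega),
        proj_mul_left (tensorAlgebra_basis_mem b v), if_pos (by omega)]
      refine TwoSidedIdeal.mul_mem_right _ _ _ (TwoSidedIdeal.mul_mem_left _ _ _ ?_)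
      -- What is left is the component of `p k` of this degree: in degree `N` it belongs to `R`,
      -- above `N` it is zero.
      rcases eq_or_lt_of_le (show N ≤ n - w.length - v.length by omega) with hN | hN
      · rw [← hN]
        exact TwoSidedIdeal.subset_span ⟨p k, hpk, rfl⟩
      · have := hP hpk
        rw [filt_eq_filtLT_succ] at this
        rw [proj_eq_zero_of_mem_filtLT hN this]
        exact TwoSidedIdeal.zero_mem _
    | zero => rw [map_zero]; exact TwoSidedIdeal.zero_mem _
    | add x y _ _ hx hy => rw [map_add]; exact TwoSidedIdeal.add_mem _ hx hy
    | smul c x _ hx => rw [map_smul]; exact smul_mem_relIdeal c hx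
  have h3 := h2 _ h1
  rwa [map_sub, proj_of_mem hx, proj_eq_zero_of_mem_filtLT le_rfl hy, sub_zero] at h3

/-- Deformations of the relations `[q, e_k] = 0`, `q` a diagonal quadratic form in at least two
variables, which satisfy the deformed syzygy `[q, q] = 0` have the PBW property. -/
theorem hasPBW_diagRel {X : Type*} [Fintype X] [LinearOrder X] {t u : X} (b : Module.Basis X K V)
    {a : X → K} {J : X → TensorAlgebra K V} (ha : ∀ k, a k ≠ 0)
    (hJ : ∀ k, J k ∈ filt K V 2)
    (ht : ∀ k, k ≠ t → k < t) (hut : u ≠ t) (hu : ∀ k, k ≠ t → k ≠ u → k < u)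
    (hsyz : ∑ k, a k • (TensorAlgebra.ι K (b k) * diagRel b.tensorAlgebra a J k +
        diagRel b.tensorAlgebra a J k * TensorAlgebra.ι K (b k)) ∈
      Submodule.span K (Set.range (diagRel b.tensorAlgebra a J)))
    (hP : Submodule.span K (Set.range (diagRel b.tensorAlgebra a J)) ≤ filt K V 3) :
    HasPBW 3 (Submodule.span K (Set.range (diagRel b.tensorAlgebra a J))) hP := by
  refine hasPBW_of_mem_span b hP fun n x hx hxP => ?_
  refine mem_multSpan_diag (tensorAlgebra_basis_mul b) ha
    (fun k => filt_le_wordSpan b 2 (hJ k)) ht hut hu ?_ (mem_span_of_mem_relIdeal b hxP)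
    (filt_le_wordSpan b n hx)
  simpa only [tensorAlgebra_basis_of] using hsyz

end Ideals

/-! ### The super Yang–Mills relations and their syzygy -/

section CubicPolynomials

open FreeMonoid (of)

variable {K : Type*} [Field K] {s : ℕ}

/-- The noncommutative polynomial of degree at most `3` with the given coefficients. -/
def cubicPoly (c₃ : Fin (s + 1) → Fin (s + 1) → Fin (s + 1) → K)
    (c₂ : Fin (s + 1) → Fin (s + 1) → K) (c₁ : Fin (s + 1) → K) (c₀ : K) : Gen K s :=
  (∑ α, ∑ β, ∑ γ, c₃ α β γ • (S K α * S K β * S K γ)) + (∑ α, ∑ β, c₂ α β • (S K α * S K β)) +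
    (∑ α, c₁ α • S K α) + algebraMap K _ c₀

/-- Words form a basis of the tensor algebra, and those of length 3, 2, 1, 0 are pairwise distinct,
so each coefficient can be read off. -/
theorem cubicPoly_eq_zero {c₃ : Fin (s + 1) → Fin (s + 1) → Fin (s + 1) → K}
    {c₂ : Fin (s + 1) → Fin (s + 1) → K} {c₁ : Fin (s + 1) → K} {c₀ : K}
    (h : cubicPoly c₃ c₂ c₁ c₀ = 0) :
    (∀ α β γ, c₃ α β γ = 0) ∧ (∀ α β, c₂ α β = 0) ∧ (∀ α, c₁ α = 0) ∧ c₀ = 0 := by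
  classical
  set B := (Pi.basisFun K (Fin (s + 1))).tensorAlgebra with hBdef
  have hB : ∀ v w, B (v * w) = B v * B w := tensorAlgebra_basis_mul _
  have hS : ∀ α, S K α = B (of α) := fun α => by
    rw [hBdef, tensorAlgebra_basis_of, S, Pi.basisFun_apply]
  have e : B.repr (cubicPoly c₃ c₂ c₁ c₀) =
      (∑ α, ∑ β, ∑ γ, Finsupp.single (of α * of β * of γ) (c₃ α β γ)) +
      (∑ α, ∑ β, Finsupp.single (of α * of β) (c₂ α β)) +
      (∑ α, Finsupp.single (of α) (c₁ α)) + Finsupp.single 1 c₀ := by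
    have h1 : algebraMap K (Gen K s) c₀ = c₀ • B 1 := by
      rw [basis_one hB, Algebra.algebraMap_eq_smul_one]
    simp only [cubicPoly, hS, ← hB, h1, map_add, map_sum, map_smul, B.repr_self,
      Finsupp.smul_single, smul_eq_mul, mul_one]
  rw [h, map_zero] at e
  have i1 : ∀ α β γ α' β' γ' : Fin (s + 1), of α * of β * of γ = of α' * of β' * of γ' ↔
      α = α' ∧ β = β' ∧ γ = γ' := fun α β γ α' β' γ' => by
    change [α, β, γ] = [α', β', γ'] ↔ _
    simp
  have i2 : ∀ α β α' β' : Fin (s + 1), of α * of β = of α' * of β' ↔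
      α = α' ∧ β = β' := fun α β α' β' => by
    change [α, β] = [α', β'] ↔ _
    simp
  have len : ∀ u v : FreeMonoid (Fin (s + 1)), u.length ≠ v.length → u ≠ v :=
    fun u v h h' => h (congrArg _ h')
  have l32 : ∀ α β γ α' β' : Fin (s + 1), of α * of β * of γ ≠ of α' * of β' :=
    fun _ _ _ _ _ => len _ _ (by simp [FreeMonoid.length_mul])
  have l31 : ∀ α β γ α' : Fin (s + 1), of α * of β * of γ ≠ of α' :=
    fun _ _ _ _ => len _ _ (by simp [FreeMonoid.length_mul])
  have l30 : ∀ α β γ : Fin (s + 1), of α * of β * of γ ≠ 1 :=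
    fun _ _ _ => len _ _ (by simp [FreeMonoid.length_mul])
  have l21 : ∀ α β α' : Fin (s + 1), of α * of β ≠ of α' :=
    fun _ _ _ => len _ _ (by simp [FreeMonoid.length_mul])
  have l20 : ∀ α β : Fin (s + 1), of α * of β ≠ 1 :=
    fun _ _ => len _ _ (by simp [FreeMonoid.length_mul])
  have l10 : ∀ α : Fin (s + 1), of α ≠ 1 := fun _ => len _ _ (by simp)
  refine ⟨fun α β γ => ?_, fun α β => ?_, fun α => ?_, ?_⟩
  · have := DFunLike.congr_fun e (of α * of β * of γ)
    simpa [Finsupp.single_apply, i1, (l32 _ _ _ _ _).symm, (l31 _ _ _ _).symm, (l30 _ _ _).symm,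
      ite_and, eq_comm] using this
  · have := DFunLike.congr_fun e (of α * of β)
    simpa [Finsupp.single_apply, i2, l32, (l21 _ _ _).symm, (l20 _ _).symm,
      ite_and, eq_comm] using this
  · have := DFunLike.congr_fun e (of α)
    simpa [Finsupp.single_apply, FreeMonoid.of_injective.eq_iff, l31, l21, (l10 _).symm,
      eq_comm] using this
  · have := DFunLike.congr_fun e 1
    simpa [Finsupp.single_apply, l30, l20, l10, eq_comm] using this

theorem current_injective {j3 j3' : Fin (s + 1) → Fin (s + 1) → Fin (s + 1) → K}
    {j2 j2' : Fin (s + 1) → Fin (s + 1) → K} {j1 j1' : Fin (s + 1) → K}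
    (h : ∀ ρ, current j3 j2 j1 ρ - current j3' j2' j1' ρ = 0) : j3 = j3' ∧ j2 = j2' ∧ j1 = j1' := by
  have key : ∀ ρ, cubicPoly (fun _ _ _ => 0) (fun α β => j3 α β ρ - j3' α β ρ)
      (fun α => j2 α ρ - j2' α ρ) (j1 ρ - j1' ρ) = 0 := by
    intro ρ
    rw [← h ρ]
    simp only [cubicPoly, current, sub_smul, Finset.sum_sub_distrib, map_sub, zero_smul,
      Finset.sum_const_zero]
    abel
  refine ⟨?_, ?_, ?_⟩
  · ext α β ρ
    exact sub_eq_zero.1 ((cubicPoly_eq_zero (key ρ)).2.1 α β)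
  · ext α ρ
    exact sub_eq_zero.1 ((cubicPoly_eq_zero (key ρ)).2.2.1 α)
  · ext ρ
    exact sub_eq_zero.1 (cubicPoly_eq_zero (key ρ)).2.2.2

end CubicPolynomials

/-! ### The identity `[q, q] = 0` and its deformation -/

section Syzygy

variable {K : Type*} [Field K] {s : ℕ}

/-- The quadratic element `g^{λμ} S_λ S_μ`. -/
def quadForm (g : Matrix (Fin (s + 1)) (Fin (s + 1)) K) : Gen K s :=
  ∑ l, ∑ m, g⁻¹ l m • (S K l * S K m)

/-- The generator with raised index, `S^ρ = g^{ρν} S_ν`. -/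
def raisedS (g : Matrix (Fin (s + 1)) (Fin (s + 1)) K) (ρ : Fin (s + 1)) : Gen K s :=
  ∑ n, g⁻¹ ρ n • S K n

variable {g : Matrix (Fin (s + 1)) (Fin (s + 1)) K}

theorem inv_apply_comm (hsymm : g.IsSymm) (α β : Fin (s + 1)) : g⁻¹ α β = g⁻¹ β α :=
  hsymm.inv.apply β α

theorem superW_eq (hsymm : g.IsSymm) (ρ : Fin (s + 1)) :
    superW g ρ = quadForm g * raisedS g ρ - raisedS g ρ * quadForm g := by
  simp only [superW, quadForm, raisedS, sub_smul, Finset.sum_sub_distrib, Finset.sum_mul,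
    Finset.mul_sum, smul_mul_smul_comm, mul_assoc]
  have cycle : ∀ f : Fin (s + 1) → Fin (s + 1) → Fin (s + 1) → Gen K s,
      ∑ x, ∑ y, ∑ z, f x y z = ∑ y, ∑ z, ∑ x, f x y z := fun f => by
    rw [Finset.sum_comm]
    exact Finset.sum_congr rfl fun _ _ => Finset.sum_comm
  rw [cycle fun x y z => (g⁻¹ y z * g⁻¹ ρ x) • (S K y * (S K z * S K x)),
    ← cycle fun x y z => (g⁻¹ ρ x * g⁻¹ y z) • (S K x * (S K y * S K z))]
  refine congrArg (· - _) ?_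
  refine Finset.sum_congr rfl fun x _ => Finset.sum_congr rfl fun y _ =>
    Finset.sum_congr rfl fun z _ => ?_
  rw [inv_apply_comm hsymm z ρ]

theorem sum_S_mul_raisedS : ∑ ρ, S K ρ * raisedS g ρ = quadForm g := by
  simp only [quadForm, raisedS, Finset.mul_sum, mul_smul_comm]

theorem sum_raisedS_mul_S (hsymm : g.IsSymm) : ∑ ρ, raisedS g ρ * S K ρ = quadForm g := by
  simp only [quadForm, raisedS, Finset.sum_mul, smul_mul_assoc]
  rw [Finset.sum_comm]
  simp only [inv_apply_comm hsymm]

theorem sum_S_mul_mul_raisedS (hsymm : g.IsSymm) (x : Gen K s) :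
    ∑ ρ, S K ρ * x * raisedS g ρ = ∑ ρ, raisedS g ρ * x * S K ρ := by
  simp only [raisedS, Finset.sum_mul, Finset.mul_sum, smul_mul_assoc, mul_smul_comm]
  rw [Finset.sum_comm]
  simp only [inv_apply_comm hsymm]

/-- The syzygy of the relations expressing `[q, q] = 0`. -/
theorem sum_anticomm_superW (hsymm : g.IsSymm) :
    ∑ ρ, (S K ρ * superW g ρ + superW g ρ * S K ρ) = 0 := by
  -- After summation the first pair cancels by symmetry of `g`, and the second becomes `q q - q q`.
  have e : ∀ ρ, S K ρ * superW g ρ + superW g ρ * S K ρ =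
      S K ρ * quadForm g * raisedS g ρ - raisedS g ρ * quadForm g * S K ρ +
      (quadForm g * (raisedS g ρ * S K ρ) - S K ρ * raisedS g ρ * quadForm g) := by
    intro ρ
    rw [superW_eq hsymm]
    noncomm_ring
  simp only [e, Finset.sum_add_distrib, Finset.sum_sub_distrib, ← Finset.mul_sum,
    ← Finset.sum_mul, sum_S_mul_raisedS, sum_raisedS_mul_S hsymm, sum_S_mul_mul_raisedS hsymm,
    sub_self, add_zero]

variable {j3 : Fin (s + 1) → Fin (s + 1) → Fin (s + 1) → K}
  {j2 : Fin (s + 1) → Fin (s + 1) → K} {j1 : Fin (s + 1) → K}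

theorem sum_anticomm_current :
    ∑ ρ, (S K ρ * current j3 j2 j1 ρ + current j3 j2 j1 ρ * S K ρ) =
      cubicPoly (fun α β γ => j3 β γ α + j3 α β γ) (fun α β => j2 β α + j2 α β)
        (fun α => 2 * j1 α) 0 := by
  have h3 : ∑ ρ, (∑ α, ∑ β, j3 α β ρ • (S K α * S K β)) * S K ρ =
      ∑ α, ∑ β, ∑ γ, j3 α β γ • (S K α * S K β * S K γ) := by
    simp only [Finset.sum_mul, smul_mul_assoc]
    rw [Finset.sum_comm]
    exact Finset.sum_congr rfl fun α _ => Finset.sum_comm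
  have h2 : ∑ ρ, (∑ α, j2 α ρ • S K α) * S K ρ = ∑ α, ∑ β, j2 α β • (S K α * S K β) := by
    simp only [Finset.sum_mul, smul_mul_assoc]
    exact Finset.sum_comm
  have h1 : ∀ ρ, algebraMap K (Gen K s) (j1 ρ) * S K ρ = j1 ρ • S K ρ := fun ρ =>
    (Algebra.smul_def _ _).symm
  have h1' : ∀ ρ, S K ρ * algebraMap K (Gen K s) (j1 ρ) = j1 ρ • S K ρ := fun ρ => by
    rw [← Algebra.commutes, Algebra.smul_def]
  simp only [current, mul_add, add_mul, Finset.sum_add_distrib, h3, h2, h1, h1', cubicPoly,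
    add_smul, two_mul, map_zero, add_zero, Finset.mul_sum, mul_smul_comm, mul_assoc]
  abel

theorem sum_smul_relation (c : Fin (s + 1) → K) :
    ∑ ρ, c ρ • (superW g ρ - current j3 j2 j1 ρ) =
      cubicPoly (fun α β γ => ∑ ρ, c ρ * (g⁻¹ α β * g⁻¹ γ ρ - g⁻¹ ρ α * g⁻¹ β γ))
        (fun α β => -∑ ρ, c ρ * j3 α β ρ) (fun α => -∑ ρ, c ρ * j2 α ρ) (-∑ ρ, c ρ * j1 ρ) := by
  have h3 : ∑ ρ, c ρ • superW g ρ = ∑ α, ∑ β, ∑ γ,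
      (∑ ρ, c ρ * (g⁻¹ α β * g⁻¹ γ ρ - g⁻¹ ρ α * g⁻¹ β γ)) • (S K α * S K β * S K γ) := by
    simp only [superW, Finset.smul_sum, Finset.sum_smul, smul_smul]
    rw [Finset.sum_comm]
    refine Finset.sum_congr rfl fun α _ => ?_
    rw [Finset.sum_comm]
    exact Finset.sum_congr rfl fun β _ => Finset.sum_comm
  have h2 : ∑ ρ, c ρ • (∑ α, ∑ β, j3 α β ρ • (S K α * S K β)) =
      ∑ α, ∑ β, (∑ ρ, c ρ * j3 α β ρ) • (S K α * S K β) := by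
    simp only [Finset.smul_sum, Finset.sum_smul, smul_smul]
    rw [Finset.sum_comm]
    exact Finset.sum_congr rfl fun β _ => Finset.sum_comm
  have h1 : ∑ ρ, c ρ • (∑ α, j2 α ρ • S K α) = ∑ α, (∑ ρ, c ρ * j2 α ρ) • S K α := by
    simp only [Finset.smul_sum, Finset.sum_smul, smul_smul]
    exact Finset.sum_comm
  have h0 : ∑ ρ, c ρ • algebraMap K (Gen K s) (j1 ρ) = algebraMap K _ (∑ ρ, c ρ * j1 ρ) := by
    simp only [map_sum, map_mul, Algebra.smul_def]
  simp only [smul_sub, Finset.sum_sub_distrib, h3, current, smul_add, Finset.sum_add_distrib, h2,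
    h1, h0, cubicPoly, neg_smul, Finset.sum_neg_distrib, map_neg]
  abel

theorem cubicPoly_sub (c₃ c₃' : Fin (s + 1) → Fin (s + 1) → Fin (s + 1) → K)
    (c₂ c₂' : Fin (s + 1) → Fin (s + 1) → K) (c₁ c₁' : Fin (s + 1) → K) (c₀ c₀' : K) :
    cubicPoly c₃ c₂ c₁ c₀ - cubicPoly c₃' c₂' c₁' c₀' =
      cubicPoly (fun α β γ => c₃ α β γ - c₃' α β γ) (fun α β => c₂ α β - c₂' α β)
        (fun α => c₁ α - c₁' α) (c₀ - c₀') := by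
  simp only [cubicPoly, sub_smul, Finset.sum_sub_distrib, map_sub]
  abel

/-- The deformed syzygy determines the current. -/
theorem anticomm_current_eq_iff (h2 : (2 : K) ≠ 0) (hsymm : g.IsSymm) (b : Fin (s + 1) → K) :
    ∑ ρ, (S K ρ * current j3 j2 j1 ρ + current j3 j2 j1 ρ * S K ρ) =
      ∑ ρ, b ρ • (superW g ρ - current j3 j2 j1 ρ) ↔
    ∃ ω : Matrix (Fin (s + 1)) (Fin (s + 1)) K,
      (∀ α β, ω α β = -ω β α) ∧ CurrentForm g j3 j2 j1 b ω := by
  have hs := inv_apply_comm hsymm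
  set C : Fin (s + 1) → K := fun α => ∑ ρ, b ρ * g⁻¹ α ρ with hC
  have e3 : ∀ α β γ, ∑ ρ, (g⁻¹ α γ * g⁻¹ β ρ - g⁻¹ β γ * g⁻¹ α ρ) * b ρ =
      g⁻¹ α γ * C β - g⁻¹ β γ * C α := by
    intro α β γ
    simp only [hC, Finset.mul_sum, ← Finset.sum_sub_distrib]
    exact Finset.sum_congr rfl fun ρ _ => by ring
  have e3' : ∀ α β γ, ∑ ρ, b ρ * (g⁻¹ α β * g⁻¹ γ ρ - g⁻¹ ρ α * g⁻¹ β γ) =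
      g⁻¹ α β * C γ - g⁻¹ β γ * C α := by
    intro α β γ
    simp only [hC, Finset.mul_sum, ← Finset.sum_sub_distrib]
    exact Finset.sum_congr rfl fun ρ _ => by rw [hs ρ α]; ring
  -- Contracting with `b` gives `C^α C^β - C^β C^α`.
  have e2 : (∀ α β γ, j3 α β γ = g⁻¹ α γ * C β - g⁻¹ β γ * C α) → ∀ α β,
      ∑ ρ, b ρ * j3 α β ρ = 0 := by
    intro h α β
    have : ∑ ρ, b ρ * j3 α β ρ = (∑ ρ, b ρ * g⁻¹ α ρ) * C β - (∑ ρ, b ρ * g⁻¹ β ρ) * C α := by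
      simp only [h, Finset.sum_mul, ← Finset.sum_sub_distrib]
      exact Finset.sum_congr rfl fun ρ _ => by ring
    rw [this]
    simp only [hC]
    ring
  rw [sum_anticomm_current, sum_smul_relation, ← sub_eq_zero, cubicPoly_sub]
  simp only [e3']
  constructor
  · intro h
    obtain ⟨h3, hq, h1, -⟩ := cubicPoly_eq_zero h
    have hj3 : ∀ α β γ, j3 α β γ = g⁻¹ α γ * C β - g⁻¹ β γ * C α := by
      intro α β γ
      -- The cubic equation fixes `j^{βγα} + j^{αβγ}`. The alternating sum over its three cyclic
      -- shifts leaves `2 j^{αβγ}`.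
      have a1 := h3 α β γ
      have a2 := h3 β γ α
      have a3 := h3 γ α β
      rw [hs γ α] at a2 a3
      refine mul_left_cancel₀ h2 ?_
      linear_combination a1 - a2 + a3
    refine ⟨j2, fun α β => ?_, fun α β γ => by rw [e3, hj3], fun _ _ => rfl, fun α => ?_⟩
    -- The quadratic equation equates the symmetrization of `j2` with a contraction of `j3` by `b`,
    -- which vanishes by `e2`.
    · have := hq α β
      rw [e2 hj3] at this
      linear_combination this
    · have := h1 α
      have e : ∑ ρ, j2 α ρ * b ρ = ∑ ρ, b ρ * j2 α ρ :=
        Finset.sum_congr rfl fun ρ _ => mul_comm _ _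
      rw [e]
      field_simp
      linear_combination this
  · rintro ⟨ω, hω, h3, hq, h1⟩
    simp only [e3] at h3
    -- The constant term imposes nothing new: `b_ρ j^ρ` is a multiple of `ω^{ρσ} b_ρ b_σ`, zero by
    -- antisymmetry.
    have k0 : ∑ ρ, b ρ * j1 ρ = 0 := by
      have e : ∑ ρ, b ρ * ∑ σ, ω ρ σ * b σ = 0 := by
        have : ∑ ρ, b ρ * ∑ σ, ω ρ σ * b σ = -∑ ρ, b ρ * ∑ σ, ω ρ σ * b σ := by
          conv_lhs => simp only [Finset.mul_sum]; rw [Finset.sum_comm]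
          simp only [Finset.mul_sum, ← Finset.sum_neg_distrib]
          refine Finset.sum_congr rfl fun ρ _ => Finset.sum_congr rfl fun σ _ => ?_
          rw [hω σ ρ]
          ring
        have h' : 2 * ∑ ρ, b ρ * ∑ σ, ω ρ σ * b σ = 0 := by linear_combination this
        exact (mul_eq_zero.1 h').resolve_left h2
      have : ∑ ρ, b ρ * j1 ρ = -(1 / 2) * ∑ ρ, b ρ * ∑ σ, ω ρ σ * b σ := by
        rw [Finset.mul_sum]
        exact Finset.sum_congr rfl fun ρ _ => by rw [h1]; ring
      rw [this, e, mul_zero]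
    have z3 : (fun α β γ => j3 β γ α + j3 α β γ - (g⁻¹ α β * C γ - g⁻¹ β γ * C α)) =
        fun _ _ _ => 0 := by
      funext α β γ
      rw [h3, h3, hs γ α, hs β α]
      ring
    have z2 : (fun α β => j2 β α + j2 α β - -∑ ρ, b ρ * j3 α β ρ) = fun _ _ => 0 := by
      funext α β
      rw [e2 h3, hq, hq, hω β α]
      ring
    have z1 : (fun α => 2 * j1 α - -∑ ρ, b ρ * j2 α ρ) = fun _ => 0 := by
      funext α
      have e : ∑ ρ, ω α ρ * b ρ = ∑ ρ, b ρ * j2 α ρ :=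
        Finset.sum_congr rfl fun ρ _ => by rw [hq, mul_comm]
      rw [h1, e]
      field_simp
      ring
    rw [z3, z2, z1, k0]
    simp [cubicPoly]

end Syzygy

/-! ### The PBW property of the super Yang–Mills relations -/

section PBW

variable {K : Type*} [Field K] {s : ℕ} {g : Matrix (Fin (s + 1)) (Fin (s + 1)) K}

theorem span_range_combination {n M : Type*} [Fintype n] [DecidableEq n] [AddCommGroup M]
    [Module K M] {C D : Matrix n n K} (hDC : D * C = 1) (x : n → M) :
    Submodule.span K (Set.range fun i => ∑ j, C i j • x j) = Submodule.span K (Set.range x) := by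
  refine le_antisymm (Submodule.span_le.2 ?_) (Submodule.span_le.2 ?_)
  · rintro _ ⟨i, rfl⟩
    exact sum_mem fun j _ => Submodule.smul_mem _ _ (Submodule.subset_span ⟨j, rfl⟩)
  · rintro _ ⟨i, rfl⟩
    have : x i = ∑ k, D i k • ∑ j, C k j • x j := by
      simp only [Finset.smul_sum, smul_smul]
      rw [Finset.sum_comm]
      simp only [← Finset.sum_smul, ← Matrix.mul_apply, hDC, Matrix.one_apply, ite_smul, one_smul,
        zero_smul, Finset.sum_ite_eq, Finset.mem_univ, if_true]
    rw [this]
    exact sum_mem fun j _ => Submodule.smul_mem _ _ (Submodule.subset_span ⟨j, rfl⟩)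

/-- The inverse of an invertible symmetric matrix is diagonal in a suitable basis. -/
theorem exists_diagonalizing_basis (h2 : (2 : K) ≠ 0) (hsymm : g.IsSymm) (hdet : g.det ≠ 0) :
    ∃ (b : Module.Basis (Fin (s + 1)) K (Fin (s + 1) → K)) (a : Fin (s + 1) → K),
      (∀ k, a k ≠ 0) ∧ ∀ l m, g⁻¹ l m = ∑ k, a k * b k l * b k m := by
  have : Invertible (2 : K) := invertibleOfNonzero h2
  have hS : LinearMap.IsSymm (Matrix.toBilin' g) := by
    refine ⟨fun x y => ?_⟩
    simp only [Matrix.toBilin'_apply, RingHom.id_apply]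
    rw [Finset.sum_comm]
    refine Finset.sum_congr rfl fun i _ => Finset.sum_congr rfl fun j _ => ?_
    rw [hsymm.apply]
    ring
  obtain ⟨v, hv⟩ := LinearMap.BilinForm.exists_orthogonal_basis hS
  set b := v.reindex (finCongr (Module.finrank_fin_fun K (n := s + 1))) with hb
  set Q : Matrix (Fin (s + 1)) (Fin (s + 1)) K := Matrix.of fun k l => b k l with hQ
  have hoff : ∀ i j, i ≠ j → (Q * g * Q.transpose) i j = 0 := by
    intro i j hij
    have : Matrix.toBilin' g (b i) (b j) = 0 := by
      rw [hb, Module.Basis.reindex_apply, Module.Basis.reindex_apply]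
      exact hv (fun h => hij (Equiv.injective _ h))
    rw [← this, Matrix.toBilin'_apply', Matrix.dotProduct_mulVec]
    rfl
  have hQdet : IsUnit Q.det := by
    have h := (Pi.basisFun K (Fin (s + 1))).isUnit_det b
    rw [Module.Basis.det_apply] at h
    rw [← Matrix.det_transpose]
    exact h
  set d : Fin (s + 1) → K := fun i => (Q * g * Q.transpose) i i with hd
  have hdiag : Q * g * Q.transpose = Matrix.diagonal d := by
    ext i j
    rcases eq_or_ne i j with rfl | hij
    · simp [hd]
    · rw [hoff i j hij, Matrix.diagonal_apply_ne _ hij]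
  -- The product of the diagonal entries is `det g` times the square of `det Q`.
  have hdne : ∀ i, d i ≠ 0 := by
    have h := congrArg Matrix.det hdiag
    rw [Matrix.det_mul, Matrix.det_mul, Matrix.det_transpose, Matrix.det_diagonal] at h
    have h' : ∏ i, d i ≠ 0 := by
      rw [← h]
      exact mul_ne_zero (mul_ne_zero hQdet.ne_zero hdet) hQdet.ne_zero
    exact fun i => Finset.prod_ne_zero_iff.1 h' i (Finset.mem_univ _)
  refine ⟨b, fun i => (d i)⁻¹, fun i => inv_ne_zero (hdne i), ?_⟩
  have hinv : g⁻¹ = Q.transpose * Matrix.diagonal (fun i => (d i)⁻¹) * Q := by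
    refine Matrix.inv_eq_left_inv ?_
    have e1 : Matrix.diagonal (fun i => (d i)⁻¹) * (Q * g * Q.transpose) = 1 := by
      rw [hdiag, Matrix.diagonal_mul_diagonal]
      simp [hdne]
    have hQt : IsUnit Q.transpose.det := by rwa [Matrix.det_transpose]
    calc Q.transpose * Matrix.diagonal (fun i => (d i)⁻¹) * Q * g
        = Q.transpose * (Matrix.diagonal (fun i => (d i)⁻¹) * (Q * g * Q.transpose)) *
            Q.transpose⁻¹ := by
          simp only [Matrix.mul_assoc, Matrix.mul_nonsing_inv _ hQt, Matrix.mul_one]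
      _ = 1 := by rw [e1, Matrix.mul_one, Matrix.mul_nonsing_inv _ hQt]
  intro l m
  rw [hinv, Matrix.mul_apply]
  refine Finset.sum_congr rfl fun k _ => ?_
  rw [Matrix.mul_diagonal, Matrix.transpose_apply, hQ, Matrix.of_apply, Matrix.of_apply]
  ring

theorem ι_eq_sum_S (v : Fin (s + 1) → K) : TensorAlgebra.ι K v = ∑ l, v l • S K l := by
  conv_lhs => rw [← Finset.univ_sum_single v]
  simp only [map_sum, S, ← map_smul]
  refine Finset.sum_congr rfl fun l _ => ?_
  congr 1
  rw [← Pi.single_smul]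
  simp

theorem HasPBW.congr {V : Type*} [AddCommGroup V] [Module K V] {N : ℕ}
    {P P' : Submodule K (TensorAlgebra K V)} (h : P = P') {hP : P ≤ filt K V N}
    {hP' : P' ≤ filt K V N} (hpbw : HasPBW N P hP) : HasPBW N P' hP' := by
  subst h
  exact hpbw

/-- This serves the case of one generator, where every relation is `0 = 0`. -/
theorem hasPBW_bot {V : Type*} [AddCommGroup V] [Module K V] {N : ℕ}
    (hP : (⊥ : Submodule K (TensorAlgebra K V)) ≤ filt K V N) : HasPBW N ⊥ hP := by
  refine (hasPBW_iff hP).2 fun n x hx y hy hxy => ?_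
  have h0 : x - y = 0 := by
    have : relIdeal (⊥ : Submodule K (TensorAlgebra K V)) ≤ ⊥ := by
      refine TwoSidedIdeal.span_le.2 ?_
      rintro _ rfl
      exact TwoSidedIdeal.zero_mem _
    simpa using this hxy
  have h1 := congrArg (proj K V n) h0
  rw [map_sub, proj_of_mem hx, proj_eq_zero_of_mem_filtLT le_rfl hy, sub_zero, map_zero] at h1
  rw [h1]
  exact TwoSidedIdeal.zero_mem _

/-- The bound 2 makes `J` a perturbation of lower degree and puts differences of currents below the
degree of the relations. -/
theorem current_mem_two (j3 : Fin (s + 1) → Fin (s + 1) → Fin (s + 1) → K)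
    (j2 : Fin (s + 1) → Fin (s + 1) → K) (j1 : Fin (s + 1) → K) (ρ : Fin (s + 1)) :
    current j3 j2 j1 ρ ∈ filt K (Fin (s + 1) → K) 2 := by
  refine add_mem (add_mem ?_ ?_) ?_
  · exact tens_le_filt 2 <| sum_mem fun α _ =>
      sum_mem fun β _ => Submodule.smul_mem _ _ (SetLike.mul_mem_graded (S_mem α) (S_mem β))
  · exact filt_mono (by norm_num : 1 ≤ 2) <| tens_le_filt 1 <| sum_mem fun α _ =>
      Submodule.smul_mem _ _ (S_mem α)
  · exact filt_mono (by norm_num : 0 ≤ 2) <| tens_le_filt 0 <|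
      SetLike.algebraMap_mem_graded (tens K (Fin (s + 1) → K)) _

variable {j3 : Fin (s + 1) → Fin (s + 1) → Fin (s + 1) → K}
  {j2 : Fin (s + 1) → Fin (s + 1) → K} {j1 : Fin (s + 1) → K}

theorem S_eq_sum_raisedS (hdet : g.det ≠ 0) (l : Fin (s + 1)) :
    S K l = ∑ ρ, g l ρ • raisedS g ρ := by
  have hg : g * g⁻¹ = 1 := Matrix.mul_nonsing_inv _ (isUnit_iff_ne_zero.2 hdet)
  simp only [raisedS, Finset.smul_sum, smul_smul]
  rw [Finset.sum_comm]
  simp only [← Finset.sum_smul, ← Matrix.mul_apply, hg, Matrix.one_apply, ite_smul, one_smul,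
    zero_smul, Finset.sum_ite_eq, Finset.mem_univ, if_true]

/-- Passing to an orthogonal basis reduces the claim to `hasPBW_diagRel`: relations and syzygy are
transported by the change of basis, and `s ≠ 0` supplies the second letter. -/
theorem hasPBW_of_anticomm_current (hs : s ≠ 0) (h2 : (2 : K) ≠ 0) (hsymm : g.IsSymm)
    (hdet : g.det ≠ 0) {c : Fin (s + 1) → K}
    (hc : ∑ ρ, (S K ρ * current j3 j2 j1 ρ + current j3 j2 j1 ρ * S K ρ) =
      ∑ ρ, c ρ • (superW g ρ - current j3 j2 j1 ρ)) :
    HasPBW 3 (relSpace (superW g) (current j3 j2 j1))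
      (relSpace_le (superW_mem g) (current_mem j3 j2 j1)) := by
  obtain ⟨b, a, ha, hba⟩ := exists_diagonalizing_basis h2 hsymm hdet
  set Q : Matrix (Fin (s + 1)) (Fin (s + 1)) K := Matrix.of fun k l => b k l with hQ
  set r : Fin (s + 1) → Gen K s := fun ρ => superW g ρ - current j3 j2 j1 ρ with hr
  have hh : g⁻¹ = Q.transpose * Matrix.diagonal a * Q := by
    ext l m
    rw [hba, Matrix.mul_apply]
    refine Finset.sum_congr rfl fun k _ => ?_
    rw [Matrix.mul_diagonal, Matrix.transpose_apply, hQ, Matrix.of_apply, Matrix.of_apply]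
    ring
  have hinv : Q.transpose * Matrix.diagonal a * (Q * g) = 1 := by
    rw [← Matrix.mul_assoc, ← hh]
    exact Matrix.nonsing_inv_mul _ (isUnit_iff_ne_zero.2 hdet)
  -- The matrix `Q g` expresses the basis vectors by the raised generators, so the same combination
  -- of the `W^ρ` is `[q, e_k]`.
  set J : Fin (s + 1) → Gen K s := fun k => ∑ ρ, (Q * g) k ρ • current j3 j2 j1 ρ with hJ
  have hι : ∀ k, TensorAlgebra.ι K (b k) = ∑ ρ, (Q * g) k ρ • raisedS g ρ := by
    intro k
    rw [ι_eq_sum_S]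
    simp only [Matrix.mul_apply, Finset.sum_smul, mul_smul]
    rw [Finset.sum_comm]
    simp only [← Finset.smul_sum, ← S_eq_sum_raisedS hdet]
    rfl
  have hq : quadForm g = ∑ k, a k • (TensorAlgebra.ι K (b k) * TensorAlgebra.ι K (b k)) := by
    have e : ∀ k, a k • (TensorAlgebra.ι K (b k) * TensorAlgebra.ι K (b k)) =
        ∑ l, ∑ m, (a k * b k l * b k m) • (S K l * S K m) := by
      intro k
      simp only [ι_eq_sum_S, Finset.sum_mul_sum, smul_mul_smul_comm, Finset.smul_sum, smul_smul,
        mul_assoc]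
    simp only [e, quadForm, hba, Finset.sum_smul]
    symm
    rw [Finset.sum_comm]
    exact Finset.sum_congr rfl fun l _ => Finset.sum_comm
  have hdiag : ∀ k, diagRel b.tensorAlgebra a J k = ∑ ρ, (Q * g) k ρ • r ρ := by
    intro k
    have e : ∑ ρ, (Q * g) k ρ • superW g ρ =
        quadForm g * TensorAlgebra.ι K (b k) - TensorAlgebra.ι K (b k) * quadForm g := by
      rw [hι]
      simp only [superW_eq hsymm, smul_sub, Finset.sum_sub_distrib, Finset.mul_sum,
        Finset.sum_mul, mul_smul_comm, smul_mul_assoc]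
    simp only [hr, smul_sub, Finset.sum_sub_distrib, e, hq, diagRel, hJ,
      tensorAlgebra_basis_mul, tensorAlgebra_basis_of, Finset.sum_mul, Finset.mul_sum,
      smul_mul_assoc, mul_smul_comm, mul_assoc]
  have hspan : Submodule.span K (Set.range (diagRel b.tensorAlgebra a J)) =
      relSpace (superW g) (current j3 j2 j1) := by
    rw [funext hdiag]
    exact span_range_combination hinv r
  have hsyz : ∑ k, a k • (TensorAlgebra.ι K (b k) * diagRel b.tensorAlgebra a J k +
        diagRel b.tensorAlgebra a J k * TensorAlgebra.ι K (b k)) ∈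
      Submodule.span K (Set.range (diagRel b.tensorAlgebra a J)) := by
    have e : ∑ k, a k • (TensorAlgebra.ι K (b k) * diagRel b.tensorAlgebra a J k +
        diagRel b.tensorAlgebra a J k * TensorAlgebra.ι K (b k)) =
        ∑ l, (S K l * r l + r l * S K l) := by
      have hcoef : ∀ l ρ, ∑ k, a k * (b k l * (Q * g) k ρ) = if l = ρ then 1 else 0 := by
        intro l ρ
        rw [← Matrix.one_apply, ← hinv, Matrix.mul_apply]
        refine Finset.sum_congr rfl fun k _ => ?_
        rw [Matrix.mul_diagonal, Matrix.transpose_apply, hQ, Matrix.of_apply]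
        ring
      -- By `hcoef` the contraction is independent of the basis for any bilinear `β`; multiplication
      -- and its flip give the two halves of the syzygy.
      have key : ∀ β : Gen K s →ₗ[K] Gen K s →ₗ[K] Gen K s,
          ∑ k, a k • β (TensorAlgebra.ι K (b k)) (diagRel b.tensorAlgebra a J k) =
            ∑ l, β (S K l) (r l) := by
        intro β
        have e : ∀ k, a k • β (TensorAlgebra.ι K (b k)) (diagRel b.tensorAlgebra a J k) =
            ∑ l, ∑ ρ, (a k * (b k l * (Q * g) k ρ)) • β (S K l) (r ρ) := by
          intro k
          rw [hdiag, ι_eq_sum_S, map_sum β, LinearMap.sum_apply, Finset.smul_sum]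
          refine Finset.sum_congr rfl fun l _ => ?_
          rw [map_smul β, LinearMap.smul_apply, map_sum, Finset.smul_sum, Finset.smul_sum]
          refine Finset.sum_congr rfl fun ρ _ => ?_
          rw [map_smul, smul_smul, smul_smul, mul_assoc]
        simp only [e]
        rw [Finset.sum_comm]
        refine Finset.sum_congr rfl fun l _ => ?_
        rw [Finset.sum_comm]
        simp only [← Finset.sum_smul, hcoef, ite_smul, one_smul, zero_smul, Finset.sum_ite_eq,
          Finset.mem_univ, if_true]
      have k1 := key (LinearMap.mul K (Gen K s))
      have k2 := key (LinearMap.mul K (Gen K s)).flip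
      simp only [LinearMap.mul_apply', LinearMap.flip_apply] at k1 k2
      simp only [smul_add, Finset.sum_add_distrib, k1, k2]
    have e' : ∑ l, (S K l * r l + r l * S K l) = -∑ ρ, c ρ • r ρ := by
      rw [hr, ← hc, ← zero_sub, ← sum_anticomm_superW hsymm, ← Finset.sum_sub_distrib]
      refine Finset.sum_congr rfl fun l _ => ?_
      simp only [mul_sub, sub_mul]
      abel
    rw [e, e', hspan]
    exact neg_mem (sum_mem fun ρ _ => Submodule.smul_mem _ _ (Submodule.subset_span ⟨ρ, rfl⟩))
  have hJ2 : ∀ k, J k ∈ filt K (Fin (s + 1) → K) 2 := fun k =>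
    sum_mem fun ρ _ => Submodule.smul_mem _ _ (current_mem_two j3 j2 j1 ρ)
  have hP : Submodule.span K (Set.range (diagRel b.tensorAlgebra a J)) ≤ filt K _ 3 := by
    rw [hspan]
    exact relSpace_le (superW_mem g) (current_mem j3 j2 j1)
  refine HasPBW.congr hspan (hasPBW_diagRel (t := Fin.last s) (u := ⟨s - 1, by omega⟩)
    b ha hJ2 ?_ ?_ ?_ hsyz hP)
  · intro k hk
    exact lt_of_le_of_ne (Fin.le_last k) hk
  · intro h
    have := congrArg Fin.val h
    simp at this
    omega
  · intro k hk hk'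
    have h1 : k.val ≠ s := fun h => hk (Fin.ext h)
    have h3 : k.val ≠ s - 1 := fun h => hk' (Fin.ext h)
    have := k.isLt
    exact Fin.lt_def.2 (show k.val < s - 1 by omega)

/-- Inserting `W^ρ - J^ρ` in the syzygy leaves an element of the ideal of degree at most 3, and PBW
forces such elements into the span of the relations. -/
theorem anticomm_current_eq_of_hasPBW (hsymm : g.IsSymm)
    (h : HasPBW 3 (relSpace (superW g) (current j3 j2 j1))
      (relSpace_le (superW_mem g) (current_mem j3 j2 j1))) :
    ∃ c : Fin (s + 1) → K,
      ∑ ρ, (S K ρ * current j3 j2 j1 ρ + current j3 j2 j1 ρ * S K ρ) =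
        ∑ ρ, c ρ • (superW g ρ - current j3 j2 j1 ρ) := by
  set P := relSpace (superW g) (current j3 j2 j1) with hPdef
  set x := ∑ ρ, (S K ρ * current j3 j2 j1 ρ + current j3 j2 j1 ρ * S K ρ) with hx
  have hrel : ∀ ρ, superW g ρ - current j3 j2 j1 ρ ∈ relIdeal P := fun ρ =>
    TwoSidedIdeal.subset_span (Submodule.subset_span ⟨ρ, rfl⟩)
  have hJ : ∀ ρ, current j3 j2 j1 ρ ∈ filtLT K (Fin (s + 1) → K) 3 := fun ρ =>
    filt_eq_filtLT_succ (K := K) (V := Fin (s + 1) → K) 2 ▸ current_mem_two j3 j2 j1 ρ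
  have hxP : x ∈ relIdeal P := by
    have e : x = -∑ ρ, (S K ρ * (superW g ρ - current j3 j2 j1 ρ) +
        (superW g ρ - current j3 j2 j1 ρ) * S K ρ) := by
      rw [hx, ← zero_sub, ← sum_anticomm_superW hsymm, ← Finset.sum_sub_distrib]
      refine Finset.sum_congr rfl fun l _ => ?_
      simp only [mul_sub, sub_mul]
      abel
    rw [e]
    exact neg_mem (sum_mem fun ρ _ => add_mem (TwoSidedIdeal.mul_mem_left _ _ _ (hrel ρ))
      (TwoSidedIdeal.mul_mem_right _ _ _ (hrel ρ)))
  have hx3 : x ∈ filt K (Fin (s + 1) → K) 3 := by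
    rw [filt_eq_filtLT_succ]
    refine sum_mem fun ρ _ => add_mem ?_ (mul_mem_filtLT_right (S_mem ρ) (hJ ρ))
    have := mul_mem_filtLT_left (S_mem ρ) (hJ ρ)
    exact this
  have h1 := (hasPBW_iff _).1 h 3 (proj K _ 3 x) (proj_mem 3 x) _ (neg_mem (sub_proj_mem hx3))
    (by simpa using hxP)
  have h3 := proj_mem_of_mem_relIdeal_homPart h1 le_rfl
  rw [if_pos rfl, proj_of_mem (proj_mem 3 x)] at h3
  obtain ⟨p, hp, hpx⟩ := h3
  -- Here `p` is a combination of relations with the same cubic part as `x`; the difference has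
  -- degree below 3 and lies in the ideal, so it is zero.
  have hproj : proj K _ 3 (x - p) = 0 := by rw [map_sub, hpx, sub_self]
  have hlow : x - p ∈ filtLT K (Fin (s + 1) → K) 3 := by
    have := sub_proj_mem (sub_mem hx3 (relSpace_le (superW_mem g) (current_mem j3 j2 j1) hp))
    rwa [hproj, sub_zero] at this
  have h0 := eq_zero_of_mem_relIdeal h le_rfl hlow
    (sub_mem hxP (TwoSidedIdeal.subset_span hp))
  obtain ⟨c, hc⟩ := (Submodule.mem_span_range_iff_exists_fun K).1 hp
  exact ⟨c, by rw [hc]; exact sub_eq_zero.1 h0⟩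

theorem hasPBW_iff_exists_currentForm (h2 : (2 : K) ≠ 0) (hsymm : g.IsSymm) (hdet : g.det ≠ 0) :
    HasPBW 3 (relSpace (superW g) (current j3 j2 j1))
        (relSpace_le (superW_mem g) (current_mem j3 j2 j1)) ↔
      ∃ (b : Fin (s + 1) → K) (ω : Matrix (Fin (s + 1)) (Fin (s + 1)) K),
        (∀ α β, ω α β = -ω β α) ∧ CurrentForm g j3 j2 j1 b ω := by
  constructor
  · intro h
    obtain ⟨c, hc⟩ := anticomm_current_eq_of_hasPBW hsymm h
    exact ⟨c, (anticomm_current_eq_iff h2 hsymm c).1 hc⟩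
  · rintro ⟨b, ω, hω, hform⟩
    rcases eq_or_ne s 0 with rfl | hs
    -- With one generator `W` vanishes identically, and the formulas with `ω = 0` make the current
    -- vanish too.
    · have : Subsingleton (Fin (0 + 1)) := inferInstanceAs (Subsingleton (Fin 1))
      have hω0 : ω = 0 := by
        ext i j
        have h := hω i j
        rw [Subsingleton.elim j i] at h ⊢
        have h' : 2 * ω i i = 0 := by linear_combination h
        exact (mul_eq_zero.1 h').resolve_left h2
      obtain ⟨h3, hq, h1⟩ := hform
      have hbot : relSpace (superW g) (current j3 j2 j1) = ⊥ := by
        refine Submodule.span_eq_bot.2 ?_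
        rintro _ ⟨ρ, rfl⟩
        fin_cases ρ
        simp [superW, current, h3, hq, h1, hω0]
      exact HasPBW.congr hbot.symm (hasPBW_bot bot_le)
    · exact hasPBW_of_anticomm_current hs h2 hsymm hdet
        ((anticomm_current_eq_iff h2 hsymm b).2 ⟨ω, hω, hform⟩)

end PBW

/-! ### Infinitesimal rotations of the shifted generators -/

section Rotations

variable {K : Type*} [Field K] {s : ℕ} {g : Matrix (Fin (s + 1)) (Fin (s + 1)) K}

/-- The two cross terms, each with a factor ½, coincide by symmetry of `g`. The constant is left
unspecified because it drops out of commutators. -/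
theorem casimir_eq (h2 : (2 : K) ≠ 0) (hsymm : g.IsSymm) (b : Fin (s + 1) → K) :
    ∃ c : K, casimir g b = quadForm g + ∑ l, (∑ m, g⁻¹ l m * b m) • S K l + algebraMap K _ c := by
  refine ⟨∑ l, ∑ m, g⁻¹ l m * (b m / 2 * (b l / 2)), ?_⟩
  have e : ∀ l m, g⁻¹ l m • (shiftS b l * shiftS b m) = g⁻¹ l m • (S K l * S K m) +
      (g⁻¹ l m * (b m / 2)) • S K l + (g⁻¹ l m * (b l / 2)) • S K m +
      algebraMap K (Gen K s) (g⁻¹ l m * (b m / 2 * (b l / 2))) := by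
    intro l m
    simp only [shiftS, Algebra.algebraMap_eq_smul_one, add_mul, mul_add, smul_mul_assoc,
      mul_smul_comm, one_mul, mul_one, smul_add, smul_smul]
    abel
  have e' : ∑ l, ∑ m, (g⁻¹ l m * (b l / 2)) • S K m = ∑ l, ∑ m, (g⁻¹ l m * (b m / 2)) • S K l := by
    rw [Finset.sum_comm]
    simp only [inv_apply_comm hsymm]
  have e'' : ∑ l, (∑ m, g⁻¹ l m * b m) • S K l =
      ∑ l, ∑ m, (g⁻¹ l m * (b m / 2)) • S K l + ∑ l, ∑ m, (g⁻¹ l m * (b m / 2)) • S K l := by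
    simp only [← Finset.sum_add_distrib, ← add_smul, Finset.sum_smul]
    refine Finset.sum_congr rfl fun l _ => Finset.sum_congr rfl fun m _ => ?_
    congr 1
    field_simp
    ring
  simp only [casimir, e, Finset.sum_add_distrib, e', e'', quadForm, map_sum]
  abel

/-- Constants drop out of the bracket, so it is `[q, S_ν] + C^l [S_l, S_ν]` with `C^l = g^{lm} b_m`.
Raising the index gives `W^ρ` minus the quadratic part of `J^ρ`. The rotation term becomes `ω^{τρ}
(S_τ + ½ b_τ)`, whose constant is `-½ ω^{ρτ} b_τ = j^ρ` by antisymmetry. -/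
theorem sum_smul_bracket (h2 : (2 : K) ≠ 0) (hsymm : g.IsSymm) (hdet : g.det ≠ 0)
    {b : Fin (s + 1) → K} {ω : Matrix (Fin (s + 1)) (Fin (s + 1)) K}
    (hω : ∀ α β, ω α β = -ω β α) {j3 : Fin (s + 1) → Fin (s + 1) → Fin (s + 1) → K}
    {j2 : Fin (s + 1) → Fin (s + 1) → K} {j1 : Fin (s + 1) → K}
    (hform : CurrentForm g j3 j2 j1 b ω) (ρ : Fin (s + 1)) :
    ∑ ν, g⁻¹ ρ ν • (⁅casimir g b, shiftS b ν⁆ - rotated (ω * g) b ν) =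
      superW g ρ - current j3 j2 j1 ρ := by
  obtain ⟨h3, hq, h1⟩ := hform
  obtain ⟨c, hc⟩ := casimir_eq h2 hsymm b
  set C : Fin (s + 1) → K := fun l => ∑ m, g⁻¹ l m * b m with hC
  have hbr : ∀ ν, ⁅casimir g b, shiftS b ν⁆ = quadForm g * S K ν - S K ν * quadForm g +
      ∑ l, C l • (S K l * S K ν - S K ν * S K l) := by
    intro ν
    have e1 : ∀ (x y : Gen K s) (d : K), x * (y + algebraMap K _ d) - (y + algebraMap K _ d) * x =
        x * y - y * x := fun x y d => by
      rw [mul_add, add_mul, Algebra.commutes]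
      abel
    have e2 : ∀ (x y : Gen K s) (d : K), (x + algebraMap K _ d) * y - y * (x + algebraMap K _ d) =
        x * y - y * x := fun x y d => by
      rw [mul_add, add_mul, Algebra.commutes]
      abel
    rw [hc, shiftS, Ring.lie_def, e1, e2]
    simp only [add_mul, mul_add, smul_sub, Finset.sum_sub_distrib, Finset.sum_mul, Finset.mul_sum,
      smul_mul_assoc, mul_smul_comm, hC]
    abel
  have hrot : ∑ ν, g⁻¹ ρ ν • rotated (ω * g) b ν = ∑ τ, ω τ ρ • shiftS b τ := by
    have hcoef : ∀ τ, ∑ ν, g⁻¹ ρ ν * (ω * g) τ ν = ω τ ρ := by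
      intro τ
      have h : (ω * g * g⁻¹) τ ρ = ω τ ρ := by
        rw [Matrix.mul_assoc, Matrix.mul_nonsing_inv _ (isUnit_iff_ne_zero.2 hdet), Matrix.mul_one]
      rw [← h, Matrix.mul_apply]
      exact Finset.sum_congr rfl fun ν _ => by rw [inv_apply_comm hsymm ρ ν, mul_comm]
    simp only [rotated, Finset.smul_sum, smul_smul]
    rw [Finset.sum_comm]
    simp only [← Finset.sum_smul, hcoef]
  have hrot' : ∑ τ, ω τ ρ • shiftS b τ = ∑ τ, j2 τ ρ • S K τ + algebraMap K _ (j1 ρ) := by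
    have e : j1 ρ = ∑ τ, ω τ ρ * (b τ / 2) := by
      rw [h1, Finset.mul_sum]
      refine Finset.sum_congr rfl fun τ _ => ?_
      rw [hω ρ τ]
      field_simp
    simp only [shiftS, smul_add, Finset.sum_add_distrib, e, map_sum, hq,
      Algebra.algebraMap_eq_smul_one, smul_smul]
  have hcur : ∑ ν, g⁻¹ ρ ν • ∑ l, C l • (S K l * S K ν - S K ν * S K l) =
      -∑ α, ∑ β, j3 α β ρ • (S K α * S K β) := by
    have e3 : ∀ α β, j3 α β ρ = g⁻¹ ρ α * C β - g⁻¹ ρ β * C α := by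
      intro α β
      rw [h3, inv_apply_comm hsymm ρ α, inv_apply_comm hsymm ρ β]
      simp only [hC, Finset.mul_sum, ← Finset.sum_sub_distrib]
      exact Finset.sum_congr rfl fun ρ _ => by ring
    simp only [e3, Finset.smul_sum, smul_sub, sub_smul, Finset.sum_sub_distrib, smul_smul]
    rw [Finset.sum_comm (f := fun α β => (g⁻¹ ρ β * C α) • (S K α * S K β))]
    abel
  have hW : ∑ ν, g⁻¹ ρ ν • (quadForm g * S K ν - S K ν * quadForm g) = superW g ρ := by
    simp only [superW_eq hsymm, raisedS, smul_sub, Finset.sum_sub_distrib, Finset.mul_sum,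
      Finset.sum_mul, mul_smul_comm, smul_mul_assoc]
  have e : ∀ ν, g⁻¹ ρ ν • (⁅casimir g b, shiftS b ν⁆ - rotated (ω * g) b ν) =
      g⁻¹ ρ ν • (quadForm g * S K ν - S K ν * quadForm g) +
      g⁻¹ ρ ν • ∑ l, C l • (S K l * S K ν - S K ν * S K l) - g⁻¹ ρ ν • rotated (ω * g) b ν :=
    fun ν => by rw [hbr, smul_sub, smul_add]
  simp only [e, Finset.sum_sub_distrib, Finset.sum_add_distrib, hrot, hrot', hcur, hW, current]
  abel

/-- Raising the index is an invertible recombination, so not only the ideals but the spans of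
relations agree. -/
theorem relSpace_bracket_eq (h2 : (2 : K) ≠ 0) (hsymm : g.IsSymm) (hdet : g.det ≠ 0)
    {b : Fin (s + 1) → K} {ω : Matrix (Fin (s + 1)) (Fin (s + 1)) K}
    (hω : ∀ α β, ω α β = -ω β α) {j3 : Fin (s + 1) → Fin (s + 1) → Fin (s + 1) → K}
    {j2 : Fin (s + 1) → Fin (s + 1) → K} {j1 : Fin (s + 1) → K}
    (hform : CurrentForm g j3 j2 j1 b ω) :
    relSpace (fun ν => ⁅casimir g b, shiftS b ν⁆) (rotated (ω * g) b) =
      relSpace (superW g) (current j3 j2 j1) := by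
  have h := span_range_combination (C := g⁻¹) (D := g)
    (Matrix.mul_nonsing_inv _ (isUnit_iff_ne_zero.2 hdet))
    (fun ν => ⁅casimir g b, shiftS b ν⁆ - rotated (ω * g) b ν)
  simp only [sum_smul_bracket h2 hsymm hdet hω hform] at h
  exact h.symm

theorem mul_mem_skewAdjoint (hsymm : g.IsSymm) {ω : Matrix (Fin (s + 1)) (Fin (s + 1)) K}
    (hω : ∀ α β, ω α β = -ω β α) : ω * g ∈ skewAdjointMatricesLieSubalgebra g := by
  have h : ω.transpose = -ω := by
    ext i j
    simp [hω j i]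
  rw [mem_skewAdjointMatricesLieSubalgebra, mem_skewAdjointMatricesSubmodule,
    Matrix.IsSkewAdjoint, Matrix.IsAdjointPair, Matrix.transpose_mul, hsymm.eq, h]
  simp [Matrix.mul_assoc]

/-- This inverts `ω ↦ ω g`, so every infinitesimal rotation comes from an antisymmetric `ω`. -/
theorem mul_inv_antisymm (hsymm : g.IsSymm) (hdet : g.det ≠ 0)
    {M : Matrix (Fin (s + 1)) (Fin (s + 1)) K} (hM : M ∈ skewAdjointMatricesLieSubalgebra g)
    (α β : Fin (s + 1)) : (M * g⁻¹) α β = -(M * g⁻¹) β α := by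
  have hu := isUnit_iff_ne_zero.2 hdet
  rw [mem_skewAdjointMatricesLieSubalgebra, mem_skewAdjointMatricesSubmodule,
    Matrix.IsSkewAdjoint, Matrix.IsAdjointPair] at hM
  have h : (M * g⁻¹).transpose = -(M * g⁻¹) := by
    rw [Matrix.transpose_mul, hsymm.inv.eq]
    calc g⁻¹ * M.transpose = g⁻¹ * (M.transpose * g) * g⁻¹ := by
          rw [Matrix.mul_assoc, Matrix.mul_assoc, Matrix.mul_nonsing_inv _ hu, Matrix.mul_one]
      _ = -(M * g⁻¹) := by
          rw [hM, ← Matrix.mul_assoc, Matrix.nonsing_inv_mul _ hu, Matrix.one_mul, Matrix.neg_mul]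
  simpa using congrFun (congrFun h β) α

/-- The current given by `b` and `ω` is determined by the ideal of the relations. -/
theorem currentForm_iff_relIdeal_eq (h2 : (2 : K) ≠ 0) (hsymm : g.IsSymm) (hdet : g.det ≠ 0)
    {j3 : Fin (s + 1) → Fin (s + 1) → Fin (s + 1) → K}
    {j2 : Fin (s + 1) → Fin (s + 1) → K} {j1 : Fin (s + 1) → K}
    {b : Fin (s + 1) → K} {ω : Matrix (Fin (s + 1)) (Fin (s + 1)) K}
    (hω : ∀ α β, ω α β = -ω β α) :
    CurrentForm g j3 j2 j1 b ω ↔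
      relIdeal (relSpace (superW g) (current j3 j2 j1)) =
        relIdeal (relSpace (fun ν => ⁅casimir g b, shiftS b ν⁆) (rotated (ω * g) b)) := by
  constructor
  · intro h
    rw [relSpace_bracket_eq h2 hsymm hdet hω h]
  · intro h
    -- The current prescribed by `b` and `ω` is compared with the given one. Its relations have PBW
    -- and, by `h`, the same ideal, so the difference of the currents is an ideal element of degree
    -- at most 2, hence zero.
    set k3 : Fin (s + 1) → Fin (s + 1) → Fin (s + 1) → K :=
      fun α β γ => ∑ ρ, (g⁻¹ α γ * g⁻¹ β ρ - g⁻¹ β γ * g⁻¹ α ρ) * b ρ with hk3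
    set k1 : Fin (s + 1) → K := fun α => -(1 / 2) * ∑ ρ, ω α ρ * b ρ with hk1
    have hform : CurrentForm g k3 ω k1 b ω := ⟨fun _ _ _ => rfl, fun _ _ => rfl, fun _ => rfl⟩
    rw [relSpace_bracket_eq h2 hsymm hdet hω hform] at h
    have hpbw := (hasPBW_iff_exists_currentForm h2 hsymm hdet).2 ⟨b, ω, hω, hform⟩
    have hz : ∀ ρ, current j3 j2 j1 ρ - current k3 ω k1 ρ = 0 := by
      intro ρ
      have m1 : superW g ρ - current j3 j2 j1 ρ ∈ relIdeal (relSpace (superW g) (current k3 ω k1)) := by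
        rw [← h]
        exact TwoSidedIdeal.subset_span (Submodule.subset_span ⟨ρ, rfl⟩)
      have m2 : superW g ρ - current k3 ω k1 ρ ∈ relIdeal (relSpace (superW g) (current k3 ω k1)) :=
        TwoSidedIdeal.subset_span (Submodule.subset_span ⟨ρ, rfl⟩)
      refine eq_zero_of_mem_relIdeal hpbw le_rfl ?_ (by simpa using sub_mem m2 m1)
      rw [← filt_eq_filtLT_succ 2]
      exact sub_mem (current_mem_two _ _ _ ρ) (current_mem_two _ _ _ ρ)
    obtain ⟨rfl, rfl, rfl⟩ := current_injective hz
    exact hform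

end Rotations

end InhomAlg

end

open InhomAlg
theorem theorem7 {K : Type*} [Field K] (h2 : (2 : K) ≠ 0) (s : ℕ)
    (g : Matrix (Fin (s + 1)) (Fin (s + 1)) K) (hsymm : g.IsSymm) (hdet : g.det ≠ 0)
    (j3 : Fin (s + 1) → Fin (s + 1) → Fin (s + 1) → K)
    (j2 : Fin (s + 1) → Fin (s + 1) → K) (j1 : Fin (s + 1) → K) :
    -- the PBW property for the relations `W^ρ = J^ρ`, `W^ρ = [g^{λμ} S_λ S_μ, S^ρ]`
    (HasPBW 3 (relSpace (superW g) (current j3 j2 j1))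
        (relSpace_le (superW_mem g) (current_mem j3 j2 j1)) ↔
      ∃ (b : Fin (s + 1) → K) (ω : Matrix (Fin (s + 1)) (Fin (s + 1)) K),
        (∀ α β, ω α β = -ω β α) ∧ CurrentForm g j3 j2 j1 b ω) ∧
    -- for given `b` and `ω`, the formulas for the current say that the relations of the algebra
    -- are `[g^{λμ} Ŝ_λ Ŝ_μ, Ŝ_ν] = ω^{τρ} g_{ρν} Ŝ_τ`
    (∀ (b : Fin (s + 1) → K) (ω : Matrix (Fin (s + 1)) (Fin (s + 1)) K),
      (∀ α β, ω α β = -ω β α) →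
        ω * g ∈ skewAdjointMatricesLieSubalgebra g ∧
        (CurrentForm g j3 j2 j1 b ω ↔
          relIdeal (relSpace (superW g) (current j3 j2 j1)) =
            relIdeal (relSpace (fun ν => ⁅casimir g b, shiftS b ν⁆) (rotated (ω * g) b))) ∧
        (CurrentForm g j3 j2 j1 b ω → ∀ ν,
          ⁅toQuot (relSpace (superW g) (current j3 j2 j1)) (casimir g b),
              toQuot (relSpace (superW g) (current j3 j2 j1)) (shiftS b ν)⁆ =
            ∑ τ, (ω * g) τ ν • toQuot (relSpace (superW g) (current j3 j2 j1)) (shiftS b τ))) ∧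
    -- the PBW property in terms of infinitesimal rotations
    (HasPBW 3 (relSpace (superW g) (current j3 j2 j1))
        (relSpace_le (superW_mem g) (current_mem j3 j2 j1)) ↔
      ∃ (b : Fin (s + 1) → K), ∃ M ∈ skewAdjointMatricesLieSubalgebra g,
        relIdeal (relSpace (superW g) (current j3 j2 j1)) =
          relIdeal (relSpace (fun ν => ⁅casimir g b, shiftS b ν⁆) (rotated M b))) ∧
    -- the relations with the opposite sign, `[S^ρ, g^{λμ} S_λ S_μ] = J^ρ`: the formula for `j^α`
    -- changes sign
    (HasPBW 3 (relSpace (fun ρ => -superW g ρ) (current j3 j2 j1))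
        (relSpace_le (fun ρ => neg_mem (superW_mem g ρ)) (current_mem j3 j2 j1)) ↔
      ∃ (b : Fin (s + 1) → K) (ω : Matrix (Fin (s + 1)) (Fin (s + 1)) K),
        (∀ α β, ω α β = -ω β α) ∧ CurrentForm g j3 j2 (fun α => -j1 α) b ω) := by
  have hpbw := hasPBW_iff_exists_currentForm (j3 := j3) (j2 := j2) (j1 := j1) h2 hsymm hdet
  refine ⟨hpbw, fun b ω hω => ⟨mul_mem_skewAdjoint hsymm hω,
    currentForm_iff_relIdeal_eq h2 hsymm hdet hω, fun hform ν => ?_⟩, ?_, ?_⟩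
  · have hmem : ⁅casimir g b, shiftS b ν⁆ - rotated (ω * g) b ν ∈
        relIdeal (relSpace (superW g) (current j3 j2 j1)) := by
      rw [← relSpace_bracket_eq h2 hsymm hdet hω hform]
      exact TwoSidedIdeal.subset_span (Submodule.subset_span ⟨ν, rfl⟩)
    rw [← toQuot_eq_zero_iff, map_sub, sub_eq_zero] at hmem
    simpa only [Ring.lie_def, map_sub, map_mul, rotated, map_sum, map_smul] using hmem
  · rw [hpbw]
    constructor
    · rintro ⟨b, ω, hω, hform⟩
      exact ⟨b, ω * g, mul_mem_skewAdjoint hsymm hω,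
        (currentForm_iff_relIdeal_eq h2 hsymm hdet hω).1 hform⟩
    · rintro ⟨b, M, hM, h⟩
      have hω := mul_inv_antisymm hsymm hdet hM
      refine ⟨b, M * g⁻¹, hω, (currentForm_iff_relIdeal_eq h2 hsymm hdet hω).2 ?_⟩
      rwa [Matrix.mul_assoc, Matrix.nonsing_inv_mul _ (isUnit_iff_ne_zero.2 hdet), Matrix.mul_one]
  -- The relations `-W = J` are `W = -J`, to which the first statement applies.
  · have hneg : relSpace (superW g) (current (fun α β γ => -j3 α β γ) (fun α β => -j2 α β)
        (fun α => -j1 α)) = relSpace (fun ρ => -superW g ρ) (current j3 j2 j1) := by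
      have e : ∀ ρ, superW g ρ - current (fun α β γ => -j3 α β γ) (fun α β => -j2 α β)
          (fun α => -j1 α) ρ = -(-superW g ρ - current j3 j2 j1 ρ) := by
        intro ρ
        simp only [current, neg_smul, Finset.sum_neg_distrib, map_neg]
        abel
      have := Submodule.span_neg (R := K) (Set.range fun ρ => -superW g ρ - current j3 j2 j1 ρ)
      rw [relSpace, relSpace, ← this]
      congr 1
      ext x
      simp only [e, Set.mem_neg, Set.mem_range, neg_eq_iff_eq_neg]
    have h' := hasPBW_iff_exists_currentForm (j3 := fun α β γ => -j3 α β γ)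
      (j2 := fun α β => -j2 α β) (j1 := fun α => -j1 α) h2 hsymm hdet
    -- Negating `b` and `ω` absorbs the sign in `j3` and `j2`, which are linear in them; the
    -- expression for `j1` is bilinear in `ω` and `b`, so there the sign survives.
    have hform : ∀ b ω, CurrentForm g (fun α β γ => -j3 α β γ) (fun α β => -j2 α β)
        (fun α => -j1 α) (-b) (-ω) ↔ CurrentForm g j3 j2 (fun α => -j1 α) b ω := by
      intro b ω
      simp [CurrentForm]
    constructor
    · intro h
      obtain ⟨b, ω, hω, hf⟩ := h'.1 (HasPBW.congr hneg.symm h)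
      refine ⟨-b, -ω, fun α β => by simp [hω α β], (hform _ _).1 ?_⟩
      simpa using hf
    · rintro ⟨b, ω, hω, hf⟩
      exact HasPBW.congr hneg (h'.2 ⟨-b, -ω, fun α β => by simp [hω α β], (hform b ω).2 hf⟩)
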